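/- Let $d\ge 1$, and let $g:[0,\infty)\to[0,1]$ be a connection function, i.e. $g$ is non-increasing and $0<\int_{\mathbb R^d} g(|x|)\,dx<\infty$. Let $K\subset\mathbb R^d$ be a bounded Borel set with non-empty interior and boundary of Lebesgue measure zero. Let $\lambda>0$ and let $(\lambda_n)$ be positive reals with $\lambda_n/n^d\to\lambda$ as $n\to\infty$. For each $n$ let $X_n$ be a homogeneous Poisson point process on $\mathbb R^d$ with density $\lambda_n$. For a function $h:[0,\infty)\to[0,1]$, the random connection model $(X_n,\lambda_n,h)$ is the random graph with vertex set $X_n$ in which any two distinct points $x,y$ of $X_n$ are connected with probability $h(|x-y|)$, independently of all other pairs and of $X_n$. (All models with the same $n$ are built from the same $X_n$ and from one family of independent marks, one per unordered pair of points, uniform on $[0,1]$ and independent of $X_n$: $x$ and $y$ are connected in $(X_n,\lambda_n,h)$ when the mark of $\{x,y\}$ is less than $h(|x-y|)$.) Put $g_n(r)=g(nr)$ and, for $R>0$, $g_{R,n}(r)=\mathbf 1_{\{r\le R/n\}}\,g(nr)$. Let $I_n(g)$ be the number of isolated vertices of $(X_n,\lambda_n,g_n)$ in $K$, and let $J_{R,n}(g)$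 be the number of isolated vertices of $(X_n,\lambda_n,g_{R,n})$ in $K$; thus $J_{R,n}(g)=I_n(g_R)$ with $g_R(r)=\mathbf 1_{\{r\le R\}}\,g(r)$. Theorem. If for every $R>0$ $$\frac{J_{R,n}(g)-\mathbb E J_{R,n}(g)}{\sqrt{\operatorname{Var} J_{R,n}(g)}}\ \longrightarrow\ N(0,1)\quad\text{in distribution as } n\to\infty,$$ then $$\frac{I_n(g)-\mathbb E I_n(g)}{\sqrt{\operatorname{Var} I_n(g)}}\ \longrightarrow\ N(0,1)\quad\text{in distribution as } n\to\infty.$$ -/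

import Mathlib

open MeasureTheory ProbabilityTheory Filter Topology Set

noncomputable section

namespace RandomConnection

/-- `d`-dimensional Euclidean space. -/
abbrev Space (d : ℕ) : Type := EuclideanSpace ℝ (Fin d)

/-- A connection function on `ℝ^d`: a non-increasing function `g : [0, ∞) → [0, 1]` such that
`0 < ∫ g(|x|) dx < ∞`. Only the values of `g` on `[0, ∞)` matter. -/
structure IsConnectionFunction (d : ℕ) (g : ℝ → ℝ) : Prop where
  mem_Icc : ∀ r : ℝ, 0 ≤ r → g r ∈ Icc (0 : ℝ) 1
  antitoneOn : AntitoneOn g (Ici 0)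
  integrable : Integrable (fun x : Space d => g ‖x‖) volume
  integral_pos : 0 < ∫ x : Space d, g ‖x‖

/-- The scaled connection function `g_n(r) = g(n r)`. -/
def scale (g : ℝ → ℝ) (n : ℕ) : ℝ → ℝ := fun r => g (n * r)

/-- The truncated function `r ↦ 1_{r ≤ ρ} h(r)`. -/
def trunc (h : ℝ → ℝ) (ρ : ℝ) : ℝ → ℝ := fun r => if r ≤ ρ then h r else 0

/-- The scaled truncation `g_{R,n}(r) = 1_{r ≤ R/n} g(n r)`. -/
def truncScale (g : ℝ → ℝ) (R : ℝ) (n : ℕ) : ℝ → ℝ := trunc (scale g n) (R / n)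

/-- Truncating at `R` and then scaling by `n` gives `g_{R,n}`. -/
theorem truncScale_eq_scale_trunc (g : ℝ → ℝ) (R : ℝ) {n : ℕ} (hn : 0 < n) :
    truncScale g R n = scale (trunc g R) n := by
  have hn' : (0 : ℝ) < n := by exact_mod_cast hn
  funext r
  simp only [truncScale, scale, trunc, le_div_iff₀ hn', mul_comm r]

/-- The number of points of the random sequence `X` that fall in `B`. -/
def pointCount {Ω : Type*} {d : ℕ} (X : ℕ → Ω → Space d) (B : Set (Space d)) (ω : Ω) : ℕ∞ :=
  {i : ℕ | X i ω ∈ B}.encard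

/-- The random points `X 0, X 1, …` enumerate a homogeneous Poisson point process on `ℝ^d` with
density `lam`: the number of points in a Borel set `B` of finite volume has the Poisson
distribution with mean `lam * |B|`, and the numbers of points in finitely many pairwise disjoint
Borel sets are independent. -/
structure IsPoissonProcess {Ω : Type*} [MeasurableSpace Ω] (P : Measure Ω) {d : ℕ}
    (lam : ℝ) (X : ℕ → Ω → Space d) : Prop where
  measurable : ∀ i, Measurable (X i)
  hasLaw_pointCount : ∀ B : Set (Space d), MeasurableSet B → volume B < ⊤ →
    HasLaw (pointCount X B)
      ((poissonMeasure (Real.toNNReal (lam * (volume B).toReal))).map (fun k : ℕ => (k : ℕ∞))) P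
  indep_pointCount : ∀ (m : ℕ) (B : Fin m → Set (Space d)), (∀ j, MeasurableSet (B j)) →
    Pairwise (fun j k => Disjoint (B j) (B k)) → iIndepFun (fun j => pointCount X (B j)) P

/-- The randomness of Poisson random connection models of density `lam`: a Poisson process
`X` of density `lam` and, independently of `X`, independent marks `U e`, uniform on `[0, 1]`,
one for every unordered pair `e` of indices (the marks of the diagonal pairs are never used). -/
structure IsMarkedPoissonProcess {Ω : Type*} [MeasurableSpace Ω] (P : Measure Ω) {d : ℕ}
    (lam : ℝ) (X : ℕ → Ω → Space d) (U : Sym2 ℕ → Ω → ℝ) : Prop where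
  poisson : IsPoissonProcess P lam X
  measurable_mark : ∀ e, Measurable (U e)
  hasLaw_mark : ∀ e, HasLaw (U e) (volume.restrict (Icc (0 : ℝ) 1)) P
  indep_marks : iIndepFun U P
  indep_points_marks : IndepFun (fun ω i => X i ω) (fun ω e => U e ω) P

/-- The random connection model with connection function `h`: the points with indices `i ≠ j` are
connected when their mark is below `h(|X i - X j|)`. Hence, given the points, distinct pairs are
connected independently of each other, a pair at distance `r` with probability `h r`. -/
def graph {Ω : Type*} {d : ℕ} (X : ℕ → Ω → Space d) (U : Sym2 ℕ → Ω → ℝ) (h : ℝ → ℝ) (ω : Ω) :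
    SimpleGraph ℕ where
  Adj i j := i ≠ j ∧ U s(i, j) ω < h (dist (X i ω) (X j ω))
  symm := ⟨fun i j hij => by
    rw [Sym2.eq_swap, dist_comm]
    exact ⟨hij.1.symm, hij.2⟩⟩
  loopless := ⟨fun _ hi => hi.1 rfl⟩

/-- The number of isolated vertices in `K` of the random connection model with connection
function `h` (for bounded `K` and a Poisson process `X` it is almost surely finite). -/
def isolatedCount {Ω : Type*} {d : ℕ} (X : ℕ → Ω → Space d) (U : Sym2 ℕ → Ω → ℝ) (h : ℝ → ℝ)
    (K : Set (Space d)) (ω : Ω) : ℝ :=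
  ({i : ℕ | X i ω ∈ K ∧ (graph X U h ω).IsIsolated i}.ncard : ℝ)

/-- The central limit theorem for the sequence `Y n`, defined on the probability spaces
`(Ω n, P n)`: `(Y n - E (Y n)) / √(Var (Y n))` converges in distribution to `N(0, 1)`. -/
def SatisfiesCLT {Ω : ℕ → Type*} [∀ n, MeasurableSpace (Ω n)] (P : ∀ n, Measure (Ω n))
    [∀ n, IsProbabilityMeasure (P n)] (Y : ∀ n, Ω n → ℝ) : Prop :=
  TendstoInDistribution
    (fun n ω => (Y n ω - ∫ ω', Y n ω' ∂(P n)) / √(variance (Y n) (P n)))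
    atTop (id : ℝ → ℝ) P (gaussianReal 0 1)

end RandomConnection

end

/-!
Write `I` for the number of isolated vertices in `K` of the model with connection function `g_n`,
and `J` for the one with the truncated function `g_{R,n}`. The same points and marks are used for
both, so `J - I ≥ 0` counts the points of `K` which are isolated after truncation only. The
central limit theorem passes from `J` to `I` because the variance of `J - I` is at most
`ε(R) * Var I` for all large `n`, where `ε(R) → 0` as `R → ∞`.

Both variances come from exact second moments. Averaging over the independent marks
(`measure_isolatedEvent`, `measure_isolatedEvent_inter`) turns the probability that given points
are isolated into an exponential functional of the other points. The Mecke formula (`mecke_one`,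
`mecke_two`) together with the Laplace functional (`laplace`) of a Poisson process then evaluates
the sum over all points and over all pairs of points. For connection functions `a ≤ b` with
integrals `A`, `B` over space and a process of density `λ` this gives
`E I_a = λ |K| exp (-λ A)` and
`E (I_a I_b) = λ |K| exp (-λ B) + λ² exp (-λ (A + B)) ∫∫_{K × K} w_{a,b}(x, y) dx dy`,
where `w_{a,b}(x, y) = (1 - max (a, b)(|x - y|)) exp (λ ∫ a(|x - z|) b(|y - z|) dz)`; these are
`integral_isolatedCount` and `integral_mul_isolatedCount`, and `w_{a,b}` is `pairFactor`.

* Since `w_{h,h} ≥ 1 - h` and `t exp (-t) ≤ exp (-1)`, the variance of `I_h` is at least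
  `(1 - exp (-1)) E I_h` (`le_variance_isolatedCount`).
* For `h' ≤ h` the differences of the factors `w` are controlled by `h - h'`, and the variance of
  `I_{h'} - I_h` is at most `λ |K|` times `λ (H - H')` times a constant that depends only on an
  upper bound of `λ H` (`variance_sub_isolatedCount_le`); here `H` and `H'` are the integrals of
  `h` and `h'`.

For `h = g_n` and `h' = g_{R,n}` scaling gives `λ_n H_n = (λ_n / n ^ d) ∫ g`, which stays bounded,
and `λ_n (H_n - H'_n) = (λ_n / n ^ d) ∫_{|x| > R} g(|x|) dx`, which is small when `R` is large.
Hence the normalized variables are close in mean (`integral_abs_normalized_sub_le`), uniformly in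
large `n`, and testing against bounded Lipschitz functions transfers the limit
(`tendstoInDistribution_of_forall_approx`).

The points come with labels in `ℕ` while a Poisson process is only specified through its counts.
The Mecke formula is therefore first shown for functionals of finitely many counts, where it is
the identity `(k + 1) p(k + 1) = r p(k)` of the Poisson weights applied in disjoint cells, and
extended to all measurable functionals of the configuration by a π-system argument for the reduced
Campbell measures.
-/

open scoped ENNReal NNReal

noncomputable section

namespace RandomConnection

/-! ### The function `exp (-a)` on `[0, ∞]` -/

/-- The function `a ↦ exp (-a)` on `[0, ∞]`, with `exp (-∞) = 0`. -/
def expNeg (a : ℝ≥0∞) : ℝ≥0∞ := EReal.exp (-(a : EReal))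

/-- The function `p ↦ -log p` from `[0, 1]` to `[0, ∞]`; it is truncated to `0` for `p > 1`. -/
def negLog (p : ℝ≥0∞) : ℝ≥0∞ := (-(ENNReal.log p)).toENNReal

lemma continuous_expNeg : Continuous expNeg :=
  ENNReal.continuous_exp.comp (continuous_neg.comp continuous_coe_ennreal_ereal)

lemma antitone_expNeg : Antitone expNeg := fun a b h => by
  simpa [expNeg] using h

@[fun_prop]
lemma measurable_expNeg : Measurable expNeg := continuous_expNeg.measurable

@[simp] lemma expNeg_zero : expNeg 0 = 1 := by simp [expNeg]

lemma expNeg_le_one (a : ℝ≥0∞) : expNeg a ≤ 1 := by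
  simpa using antitone_expNeg (zero_le : 0 ≤ a)

lemma expNeg_add (a b : ℝ≥0∞) : expNeg (a + b) = expNeg a * expNeg b := by
  unfold expNeg
  rw [← EReal.exp_add, EReal.coe_ennreal_add, EReal.neg_add, sub_eq_add_neg]
  · left; simp
  · right; simp

lemma expNeg_sum {ι : Type*} (s : Finset ι) (f : ι → ℝ≥0∞) :
    expNeg (∑ i ∈ s, f i) = ∏ i ∈ s, expNeg (f i) := by
  classical
  induction s using Finset.induction_on with
  | empty => simp
  | insert a s ha ih => rw [Finset.sum_insert ha, Finset.prod_insert ha, expNeg_add, ih]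

lemma expNeg_nsmul (n : ℕ) (a : ℝ≥0∞) : expNeg (n * a) = expNeg a ^ n := by
  have := expNeg_sum (Finset.range n) (fun _ => a)
  simpa using this

lemma expNeg_ofReal {x : ℝ} (hx : 0 ≤ x) :
    expNeg (ENNReal.ofReal x) = ENNReal.ofReal (Real.exp (-x)) := by
  unfold expNeg
  rw [EReal.coe_ennreal_ofReal, max_eq_left hx, ← EReal.coe_neg, EReal.exp_coe]

lemma expNeg_negLog {p : ℝ≥0∞} (hp : p ≤ 1) : expNeg (negLog p) = p := by
  unfold expNeg negLog
  rw [EReal.coe_toENNReal, neg_neg, ENNReal.exp_log]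
  simpa using hp

@[fun_prop]
lemma measurable_negLog : Measurable negLog := by
  unfold negLog
  have h1 : Measurable fun p : ℝ≥0∞ => -(ENNReal.log p) :=
    (continuous_neg.comp ENNReal.continuous_log).measurable
  exact measurable_ereal_toENNReal.comp h1

/-! ### The Poisson distribution -/

/-- The recursion `(n + 1) p(n + 1) = r p(n)` of the Poisson weights, from which the Mecke formula
is derived. -/
lemma succ_mul_poissonMeasure_singleton (r : ℝ≥0) (n : ℕ) :
    ((n + 1 : ℕ) : ℝ≥0∞) * poissonMeasure r {n + 1} = r * poissonMeasure r {n} := by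
  rw [poissonMeasure_singleton, poissonMeasure_singleton, ← ENNReal.ofReal_natCast,
    ← ENNReal.ofReal_coe_nnreal, ← ENNReal.ofReal_mul (by positivity),
    ← ENNReal.ofReal_mul (by positivity)]
  congr 1
  rw [Nat.factorial_succ]
  push_cast
  field_simp
  ring

/-- The Laplace transform of the Poisson distribution. -/
lemma lintegral_expNeg_poissonMeasure (r : ℝ≥0) (a : ℝ≥0∞) :
    ∫⁻ n : ℕ, expNeg (n * a) ∂(poissonMeasure r) = expNeg (r * (1 - expNeg a)) := by
  have hle := expNeg_le_one a
  set t : ℝ := (expNeg a).toReal with ht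
  have hta : expNeg a = ENNReal.ofReal t :=
    (ENNReal.ofReal_toReal (ne_top_of_le_ne_top ENNReal.one_ne_top hle)).symm
  have ht0 : 0 ≤ t := ENNReal.toReal_nonneg
  have ht1 : t ≤ 1 := by
    rw [hta] at hle
    simpa using hle
  rw [lintegral_countable']
  have : ∀ n : ℕ, expNeg (n * a) * poissonMeasure r {n}
      = ENNReal.ofReal (Real.exp (-r) * ((r * t) ^ n / n.factorial)) := by
    intro n
    rw [expNeg_nsmul, hta, poissonMeasure_singleton, ← ENNReal.ofReal_pow ht0,
      ← ENNReal.ofReal_mul (by positivity)]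
    congr 1
    rw [mul_pow]; ring
  simp_rw [this]
  have hs : HasSum (fun n : ℕ => Real.exp (-r) * ((r * t) ^ n / n.factorial))
      (Real.exp (-r) * Real.exp (r * t)) := by
    apply HasSum.mul_left
    rw [Real.exp_eq_exp_ℝ]
    exact NormedSpace.expSeries_div_hasSum_exp ((r : ℝ) * t)
  rw [← ENNReal.ofReal_tsum_of_nonneg (fun n => by positivity) hs.summable, hs.tsum_eq, hta,
    ← ENNReal.ofReal_one, ← ENNReal.ofReal_sub _ ht0, ← ENNReal.ofReal_coe_nnreal,
    ← ENNReal.ofReal_mul (by positivity), expNeg_ofReal (by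
      have : 0 ≤ 1 - t := by linarith
      positivity), ← Real.exp_add]
  congr 2; ring

section

/-! ### Configurations of points as measures -/

variable {Ω : Type*} {d : ℕ}

/-- The counting measure of the points `X k ω` with label `k ∈ T`. Removing a point from the
configuration means removing its label from `T`. -/
def config (X : ℕ → Ω → Space d) (T : Set ℕ) (ω : Ω) : Measure (Space d) :=
  (Measure.count.restrict T).map (fun k => X k ω)

lemma config_apply (X : ℕ → Ω → Space d) (T : Set ℕ) (ω : Ω) {B : Set (Space d)}
    (hB : MeasurableSet B) :
    config X T ω B = ({k | X k ω ∈ B ∧ k ∈ T}.encard : ℝ≥0∞) := by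
  have hm : Measurable fun k => X k ω := measurable_of_countable _
  rw [config, Measure.map_apply hm hB, Measure.restrict_apply (hm hB),
    Measure.count_apply (by measurability)]
  rfl

lemma lintegral_config (X : ℕ → Ω → Space d) (T : Set ℕ) (ω : Ω) {ψ : Space d → ℝ≥0∞}
    (hψ : Measurable ψ) :
    ∫⁻ z, ψ z ∂(config X T ω) = ∑' k, T.indicator (fun k => ψ (X k ω)) k := by
  have hm : Measurable fun k => X k ω := measurable_of_countable _
  rw [config, lintegral_map hψ hm, ← lintegral_indicator (by measurability), lintegral_count]

lemma config_univ_apply (X : ℕ → Ω → Space d) (ω : Ω) {B : Set (Space d)}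
    (hB : MeasurableSet B) : config X univ ω B = (pointCount X B ω : ℝ≥0∞) := by
  rw [config_apply X _ ω hB]; simp [pointCount]

lemma measurable_config [MeasurableSpace Ω] {X : ℕ → Ω → Space d} (hX : ∀ i, Measurable (X i))
    (T : Set ℕ) : Measurable (config X T) := by
  refine Measure.measurable_of_measurable_coe _ fun B hB => ?_
  have : (fun ω => config X T ω B)
      = fun ω => ∑' k, T.indicator (fun k => B.indicator (fun _ => (1 : ℝ≥0∞)) (X k ω)) k := by
    funext ω
    rw [← lintegral_config X T ω (measurable_const.indicator hB), lintegral_indicator hB]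
    simp
  rw [this]
  refine Measurable.tsum fun k => ?_
  by_cases hk : k ∈ T
  · simp only [Set.indicator_of_mem hk]
    exact (measurable_const.indicator hB).comp (hX k)
  · simp [hk]

/-! ### Counts of points in disjoint cells -/

/-- The vector of the numbers of points in the cells `D c`; an infinite number is read as `0`. -/
def cellCount {C : Type*} (X : ℕ → Ω → Space d) (D : C → Set (Space d)) (ω : Ω) (c : C) : ℕ :=
  (pointCount X (D c) ω).toNat

/-- The vector of counts that is left after one point is removed from the cell `c`; an empty cell
stays empty. -/
def removeOne {C : Type*} [DecidableEq C] (n : C → ℕ) (c : C) : C → ℕ := n - Pi.single c 1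

variable [MeasurableSpace Ω] {P : Measure Ω} {lam : ℝ} {X : ℕ → Ω → Space d}

lemma IsPoissonProcess.hasLaw_toNat_pointCount (hX : IsPoissonProcess P lam X)
    {B : Set (Space d)} (hB : MeasurableSet B) (hB' : volume B ≠ ⊤) :
    HasLaw (fun ω => (pointCount X B ω).toNat)
      (poissonMeasure (Real.toNNReal (lam * (volume B).toReal))) P := by
  have h := hX.hasLaw_pointCount B hB hB'.lt_top
  refine ⟨(Measurable.of_discrete (f := ENat.toNat)).comp_aemeasurable h.aemeasurable, ?_⟩
  rw [← Function.comp_def, ← AEMeasurable.map_map_of_aemeasurable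
    (Measurable.of_discrete (f := ENat.toNat)).aemeasurable h.aemeasurable, h.map_eq,
    Measure.map_map (by fun_prop) (by fun_prop)]
  have : (ENat.toNat ∘ fun k : ℕ => (k : ℕ∞)) = id := by funext k; simp
  rw [this, Measure.map_id]

lemma IsPoissonProcess.ae_pointCount_ne_top (hX : IsPoissonProcess P lam X)
    {B : Set (Space d)} (hB : MeasurableSet B) (hB' : volume B ≠ ⊤) :
    ∀ᵐ ω ∂P, pointCount X B ω ≠ ⊤ := by
  have h := hX.hasLaw_pointCount B hB hB'.lt_top
  rw [ae_iff]
  simp only [not_not]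
  rw [h.measure_eq (p := fun n => n = ⊤) (by measurability),
    Measure.map_apply (by fun_prop) (by measurability)]
  have : (fun k : ℕ => (k : ℕ∞)) ⁻¹' {n | n = ⊤} = ∅ := by ext k; simp
  rw [this, measure_empty]

variable {C : Type*} [Fintype C] {D : C → Set (Space d)}

lemma IsPoissonProcess.map_cellCount [IsProbabilityMeasure P] (hX : IsPoissonProcess P lam X)
    (hD : ∀ c, MeasurableSet (D c)) (hD' : ∀ c, volume (D c) ≠ ⊤)
    (hdisj : Pairwise fun c c' => Disjoint (D c) (D c')) :
    P.map (cellCount X D)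
      = Measure.pi fun c => poissonMeasure (Real.toNNReal (lam * (volume (D c)).toReal)) := by
  have hind : iIndepFun (fun c ω => (pointCount X (D c) ω).toNat) P := by
    let e := Fintype.equivFin C
    have h := hX.indep_pointCount (Fintype.card C) (fun j => D (e.symm j)) (fun j => hD _)
      (fun j k hjk => hdisj (e.symm.injective.ne hjk))
    have h2 := (h.precomp e.injective).comp (fun _ => ENat.toNat) (fun _ => .of_discrete)
    simpa [Function.comp_def] using h2
  have hlaw := fun c => hX.hasLaw_toNat_pointCount (hD c) (hD' c)
  have := (iIndepFun_iff_map_fun_eq_pi_map (fun c => (hlaw c).aemeasurable)).1 hind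
  simp_rw [(hlaw _).map_eq] at this
  exact this

lemma IsPoissonProcess.aemeasurable_cellCount (hX : IsPoissonProcess P lam X)
    (hD : ∀ c, MeasurableSet (D c)) (hD' : ∀ c, volume (D c) ≠ ⊤) :
    AEMeasurable (cellCount X D) P :=
  aemeasurable_pi_lambda _ fun c => (hX.hasLaw_toNat_pointCount (hD c) (hD' c)).aemeasurable

lemma IsPoissonProcess.lintegral_cellCount [IsProbabilityMeasure P]
    (hX : IsPoissonProcess P lam X)
    (hD : ∀ c, MeasurableSet (D c)) (hD' : ∀ c, volume (D c) ≠ ⊤)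
    (hdisj : Pairwise fun c c' => Disjoint (D c) (D c')) (g : (C → ℕ) → ℝ≥0∞) :
    ∫⁻ ω, g (cellCount X D ω) ∂P = ∑' n : C → ℕ, g n *
      ∏ c, poissonMeasure (Real.toNNReal (lam * (volume (D c)).toReal)) {n c} := by
  rw [← lintegral_map' (f := g) (measurable_of_countable g).aemeasurable
    (hX.aemeasurable_cellCount hD hD'), hX.map_cellCount hD hD' hdisj, lintegral_countable']
  simp_rw [Measure.pi_singleton]

/-- The Stein identity characterising a vector of independent Poisson counts. -/
lemma IsPoissonProcess.lintegral_cellCount_mul [DecidableEq C] [IsProbabilityMeasure P]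
    (hX : IsPoissonProcess P lam X)
    (hD : ∀ c, MeasurableSet (D c)) (hD' : ∀ c, volume (D c) ≠ ⊤)
    (hdisj : Pairwise fun c c' => Disjoint (D c) (D c')) (c : C) (g : (C → ℕ) → ℝ≥0∞) :
    ∫⁻ ω, cellCount X D ω c * g (removeOne (cellCount X D ω) c) ∂P
      = ENNReal.ofReal lam * volume (D c) * ∫⁻ ω, g (cellCount X D ω) ∂P := by
  have hr : ENNReal.ofReal lam * volume (D c)
      = (Real.toNNReal (lam * (volume (D c)).toReal) : ℝ≥0∞) := by
    conv_lhs => rw [← ENNReal.ofReal_toReal (hD' c)]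
    rw [← ENNReal.ofReal_mul' ENNReal.toReal_nonneg]
    rfl
  rw [hX.lintegral_cellCount hD hD' hdisj (fun n => (n c : ℝ≥0∞) * g (removeOne n c)),
    hX.lintegral_cellCount hD hD' hdisj, ← ENNReal.tsum_mul_left, hr]
  set r := fun c => Real.toNNReal (lam * (volume (D c)).toReal)
  -- Vectors with `n c = 0` do not contribute to the left-hand side; the others are shifted by one.
  have hinj : Function.Injective fun n : C → ℕ => n + Pi.single c 1 := add_left_injective _
  rw [← hinj.tsum_eq]
  · refine tsum_congr fun n => ?_
    have h1 : ∏ c', poissonMeasure (r c') {(n + Pi.single c 1 : C → ℕ) c'}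
        = poissonMeasure (r c) {n c + 1} *
          ∏ c' ∈ Finset.univ.erase c, poissonMeasure (r c') {n c'} := by
      rw [← Finset.mul_prod_erase _ _ (Finset.mem_univ c)]
      congr 1
      · simp
      · refine Finset.prod_congr rfl fun c' hc' => ?_
        simp [Finset.ne_of_mem_erase hc']
    have h2 := succ_mul_poissonMeasure_singleton (r c) (n c)
    simp only [removeOne, add_tsub_cancel_right]
    rw [h1, ← Finset.mul_prod_erase Finset.univ _ (Finset.mem_univ c)]
    calc _ = (((n c + 1 : ℕ) : ℝ≥0∞) * poissonMeasure (r c) {n c + 1}) * g n *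
          ∏ c' ∈ Finset.univ.erase c, poissonMeasure (r c') {n c'} := by
            simp; ring
      _ = _ := by rw [h2]; ring
  · intro n hn
    have hnc : n c ≠ 0 := by
      rintro h
      simp [h] at hn
    refine ⟨n - Pi.single c 1, ?_⟩
    funext c'
    by_cases hc : c' = c
    · subst hc; simp; omega
    · simp [hc]

end

section

/-! ### The Mecke formula for functionals of finitely many counts -/

variable {Ω : Type*} {d : ℕ} {X : ℕ → Ω → Space d}

/-- The atom of the algebra generated by the sets `B i` which consists of the points that lie in
`B i` exactly for `i ∈ s`; points outside all the sets `B i` are discarded, so that the atoms have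
finite volume when the sets `B i` do. -/
def atomCell {ι : Type*} (B : ι → Set (Space d)) (s : Set ι) : Set (Space d) :=
  {z | z ∈ ⋃ i, B i} ∩ {z | {i | z ∈ B i} = s}

section Atoms

variable {ι : Type*} {B : ι → Set (Space d)}

lemma pairwise_disjoint_atomCell (B : ι → Set (Space d)) :
    Pairwise fun s t => Disjoint (atomCell B s) (atomCell B t) := by
  intro s t hst
  rw [Set.disjoint_left]
  rintro z ⟨-, h1⟩ ⟨-, h2⟩
  exact hst (h1.symm.trans h2)

variable [Fintype ι]

lemma measurableSet_atomCell (hB : ∀ i, MeasurableSet (B i)) (s : Set ι) :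
    MeasurableSet (atomCell B s) := by
  refine (MeasurableSet.iUnion hB).inter ?_
  have : {z | {i | z ∈ B i} = s} = ⋂ i, {z | z ∈ B i ↔ i ∈ s} := by
    ext z; simp [Set.ext_iff]
  rw [this]
  refine MeasurableSet.iInter fun i => ?_
  by_cases hi : i ∈ s
  · simpa [hi] using hB i
  · simpa [hi] using (hB i).compl.mem

lemma volume_atomCell_ne_top (hB : ∀ i, volume (B i) ≠ ⊤) (s : Set ι) :
    volume (atomCell B s) ≠ ⊤ := by
  refine ne_top_of_le_ne_top ?_ (measure_mono (inter_subset_left))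
  refine ne_top_of_le_ne_top ?_ (measure_iUnion_le B)
  rw [tsum_fintype]
  exact ENNReal.sum_ne_top.2 fun i _ => hB i

open Classical in
lemma measure_eq_sum_atomCell (hB : ∀ i, MeasurableSet (B i)) (μ : Measure (Space d)) (i : ι) :
    μ (B i) = ∑ s : Set ι with i ∈ s, μ (atomCell B s) := by
  rw [← measure_biUnion_finset (fun s _ t _ hst => pairwise_disjoint_atomCell B hst)
    (fun s _ => measurableSet_atomCell hB s)]
  congr 1
  ext z
  simp only [Finset.mem_filter, Finset.mem_univ, true_and, mem_iUnion, exists_prop]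
  constructor
  · intro hz
    exact ⟨{i | z ∈ B i}, hz, mem_iUnion.2 ⟨i, hz⟩, rfl⟩
  · rintro ⟨s, hs, -, rfl⟩
    exact hs

end Atoms

variable {C : Type*} {D : C → Set (Space d)}

lemma config_univ_eq_cellCount {ω : Ω} (hD : ∀ c, MeasurableSet (D c))
    (hfin : ∀ c, pointCount X (D c) ω ≠ ⊤) (c : C) :
    config X univ ω (D c) = cellCount X D ω c := by
  rw [config_univ_apply X ω (hD c), cellCount, ← ENat.natCast_toNat (hfin c)]
  simp

variable {ι : Type*} {B : ι → Set (Space d)} {S : ι → Finset C}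

lemma indicator_eq_sum_cell (hB : ∀ i, MeasurableSet (B i)) (hD : ∀ c, MeasurableSet (D c))
    (hBD : ∀ (μ : Measure (Space d)) i, μ (B i) = ∑ c ∈ S i, μ (D c)) (i : ι) (z : Space d) :
    (B i).indicator (fun _ => (1 : ℝ≥0∞)) z = ∑ c ∈ S i, (D c).indicator (fun _ => 1) z := by
  have := hBD (Measure.dirac z) i
  simpa [Measure.dirac_apply' _ (hB i), Measure.dirac_apply' _ (hD _), Pi.one_def] using this

variable [DecidableEq C]

/-- Forgetting a label whose point lies in the cell `c` lowers the count of this cell by one. -/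
lemma config_compl_insert {T : Set ℕ} {ω : Ω} {n : C → ℕ} (hD : ∀ c, MeasurableSet (D c))
    (hdisj : Pairwise fun c c' => Disjoint (D c) (D c'))
    (hn : ∀ c, config X Tᶜ ω (D c) = n c) {i : ℕ} (hi : i ∉ T) {c : C} (hc : X i ω ∈ D c) (c' : C) :
    config X (insert i T)ᶜ ω (D c') = removeOne n c c' := by
  have h := hn c'
  rw [config_apply _ _ _ (hD _)] at h ⊢
  have h' : {k | X k ω ∈ D c' ∧ k ∈ Tᶜ}.encard = (n c' : ℕ∞) := by exact_mod_cast h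
  have hset : {k | X k ω ∈ D c' ∧ k ∈ (insert i T)ᶜ} = {k | X k ω ∈ D c' ∧ k ∈ Tᶜ} \ {i} := by
    ext k; simp; tauto
  rw [hset]
  by_cases hcc : c' = c
  · subst hcc
    rw [Set.encard_sdiff_singleton_of_mem (by exact ⟨hc, hi⟩), h']
    simp [removeOne]
  · rw [Set.sdiff_singleton_eq_self, h']
    · simp [hcc, removeOne]
    · rintro ⟨h1, -⟩
      exact Set.disjoint_left.1 (hdisj hcc) h1 hc

lemma config_compl_singleton {ω : Ω} (hD : ∀ c, MeasurableSet (D c))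
    (hdisj : Pairwise fun c c' => Disjoint (D c) (D c'))
    (hfin : ∀ c, pointCount X (D c) ω ≠ ⊤) {i : ℕ} {c : C} (hc : X i ω ∈ D c) (c' : C) :
    config X {i}ᶜ ω (D c') = removeOne (cellCount X D ω) c c' := by
  have := config_compl_insert (X := X) (T := ∅) (n := cellCount X D ω) hD hdisj
    (by simpa using config_univ_eq_cellCount hD hfin) (notMem_empty i) hc c'
  simpa using this

lemma config_compl_pair {ω : Ω} (hD : ∀ c, MeasurableSet (D c))
    (hdisj : Pairwise fun c c' => Disjoint (D c) (D c'))
    (hfin : ∀ c, pointCount X (D c) ω ≠ ⊤) {i j : ℕ} (hij : i ≠ j) {c c' : C}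
    (hc : X i ω ∈ D c) (hc' : X j ω ∈ D c') (c'' : C) :
    config X {i, j}ᶜ ω (D c'')
      = removeOne (removeOne (cellCount X D ω) c) c' c'' := by
  have := config_compl_insert (X := X) (T := {i}) hD hdisj
    (config_compl_singleton hD hdisj hfin hc) (i := j) (by simpa using hij.symm) hc' c''
  rwa [Set.pair_comm] at this

/-- The mass of `A` as a sum over labels. -/
lemma tsum_indicator_config (T : Set ℕ) (ω : Ω) {A : Set (Space d)} (hA : MeasurableSet A) :
    ∑' k, T.indicator (fun k => A.indicator (fun _ => (1 : ℝ≥0∞)) (X k ω)) k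
      = config X T ω A := by
  rw [← lintegral_config X T ω (measurable_const.indicator hA), lintegral_indicator hA]
  simp

/-- The number of ordered pairs of distinct points in `D c × D c'`, weighted by a functional of
the remaining points. -/
lemma tsum_pair_cell {ω : Ω} (hD : ∀ c, MeasurableSet (D c))
    (hdisj : Pairwise fun c c' => Disjoint (D c) (D c'))
    (hfin : ∀ c, pointCount X (D c) ω ≠ ⊤) (c c' : C) (y : ℝ≥0∞) :
    ∑' i, ∑' j, ({i}ᶜ : Set ℕ).indicator (fun j => (D c).indicator (fun _ => (1 : ℝ≥0∞)) (X i ω) *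
        (D c').indicator (fun _ => 1) (X j ω) * y) j
      = cellCount X D ω c * (removeOne (cellCount X D ω) c c' * y) := by
  have h1 : ∀ i, ∑' j, ({i}ᶜ : Set ℕ).indicator (fun j =>
      (D c).indicator (fun _ => (1 : ℝ≥0∞)) (X i ω) * (D c').indicator (fun _ => 1) (X j ω) * y) j
      = (D c).indicator (fun _ => (1 : ℝ≥0∞)) (X i ω) *
        (removeOne (cellCount X D ω) c c' * y) := by
    intro i
    by_cases hi : X i ω ∈ D c
    · rw [← config_compl_singleton hD hdisj hfin hi, ← tsum_indicator_config _ _ (hD c')]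
      simp only [hi, Set.indicator_of_mem, one_mul]
      rw [← ENNReal.tsum_mul_right]
      refine tsum_congr fun j => ?_
      rw [Set.indicator_mul_const]
    · simp [hi]
  simp_rw [h1]
  rw [ENNReal.tsum_mul_right, ← config_univ_eq_cellCount hD hfin,
    ← tsum_indicator_config _ _ (hD c)]
  simp

variable [Fintype C]

variable [MeasurableSpace Ω] {P : Measure Ω} {lam : ℝ}

/-- The Mecke formula for a functional of the numbers of points in the sets `B l`, each of which is
a union of disjoint cells `D c` (this is expressed by `hBD`). It is linear in the cells, and in
each cell it is the Stein identity for the counts. -/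
lemma IsPoissonProcess.mecke_one_of_cells [IsProbabilityMeasure P]
    (hX : IsPoissonProcess P lam X)
    (hD : ∀ c, MeasurableSet (D c)) (hD' : ∀ c, volume (D c) ≠ ⊤)
    (hdisj : Pairwise fun c c' => Disjoint (D c) (D c'))
    (hB : ∀ i, MeasurableSet (B i))
    (hBD : ∀ (μ : Measure (Space d)) i, μ (B i) = ∑ c ∈ S i, μ (D c))
    (a : ι) (F : (ι → ℝ≥0∞) → ℝ≥0∞) :
    ∫⁻ ω, ∑' i, (B a).indicator (fun _ => (1 : ℝ≥0∞)) (X i ω) *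
        F (fun l => config X {i}ᶜ ω (B l)) ∂P
      = ENNReal.ofReal lam * volume (B a) * ∫⁻ ω, F (fun l => config X univ ω (B l)) ∂P := by
  -- The functional in terms of the counts of the cells.
  let g : (C → ℕ) → ℝ≥0∞ := fun n => F fun l => ∑ c ∈ S l, (n c : ℝ≥0∞)
  have hae : ∀ᵐ ω ∂P, ∀ c, pointCount X (D c) ω ≠ ⊤ :=
    ae_all_iff.2 fun c => hX.ae_pointCount_ne_top (hD c) (hD' c)
  have hmeas : ∀ f : (C → ℕ) → ℝ≥0∞, AEMeasurable (fun ω => f (cellCount X D ω)) P := fun f =>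
    (measurable_of_countable f).comp_aemeasurable (hX.aemeasurable_cellCount hD hD')
  have hR : ∫⁻ ω, F (fun l => config X univ ω (B l)) ∂P = ∫⁻ ω, g (cellCount X D ω) ∂P := by
    refine lintegral_congr_ae ?_
    filter_upwards [hae] with ω hω
    simp_rw [hBD, g, config_univ_eq_cellCount hD hω]
  have hL : ∀ᵐ ω ∂P, ∑' i, (B a).indicator (fun _ => (1 : ℝ≥0∞)) (X i ω) *
        F (fun l => config X {i}ᶜ ω (B l))
      = ∑ c ∈ S a, cellCount X D ω c * g (removeOne (cellCount X D ω) c) := by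
    filter_upwards [hae] with ω hω
    simp_rw [← config_univ_eq_cellCount hD hω, ← tsum_indicator_config univ ω (hD _),
      ← ENNReal.tsum_mul_right]
    rw [← Summable.tsum_finsetSum (fun _ _ => ENNReal.summable)]
    refine tsum_congr fun i => ?_
    rw [indicator_eq_sum_cell hB hD hBD, Finset.sum_mul]
    refine Finset.sum_congr rfl fun c _ => ?_
    simp only [indicator_univ]
    by_cases hi : X i ω ∈ D c
    · simp_rw [hBD, g, config_compl_singleton hD hdisj hω hi]
    · simp [hi]
  rw [lintegral_congr_ae hL, lintegral_finsetSum' _ fun c _ =>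
    hmeas fun n => n c * g (removeOne n c), hR, hBD, Finset.mul_sum, Finset.sum_mul]
  exact Finset.sum_congr rfl fun c _ => hX.lintegral_cellCount_mul hD hD' hdisj c g

/-- The bivariate Mecke formula for a functional of the numbers of points in unions of cells; it
follows from two applications of the Stein identity. -/
lemma IsPoissonProcess.mecke_two_of_cells [IsProbabilityMeasure P]
    (hX : IsPoissonProcess P lam X)
    (hD : ∀ c, MeasurableSet (D c)) (hD' : ∀ c, volume (D c) ≠ ⊤)
    (hdisj : Pairwise fun c c' => Disjoint (D c) (D c'))
    (hB : ∀ i, MeasurableSet (B i))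
    (hBD : ∀ (μ : Measure (Space d)) i, μ (B i) = ∑ c ∈ S i, μ (D c))
    (a b : ι) (F : (ι → ℝ≥0∞) → ℝ≥0∞) :
    ∫⁻ ω, ∑' i, ∑' j, ({i}ᶜ : Set ℕ).indicator (fun j =>
        (B a).indicator (fun _ => (1 : ℝ≥0∞)) (X i ω) * (B b).indicator (fun _ => 1) (X j ω) *
          F (fun l => config X {i, j}ᶜ ω (B l))) j ∂P
      = ENNReal.ofReal lam * volume (B a) * (ENNReal.ofReal lam * volume (B b)) *
        ∫⁻ ω, F (fun l => config X univ ω (B l)) ∂P := by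
  -- The functional in terms of the counts of the cells.
  let g : (C → ℕ) → ℝ≥0∞ := fun n => F fun l => ∑ c ∈ S l, (n c : ℝ≥0∞)
  have hae : ∀ᵐ ω ∂P, ∀ c, pointCount X (D c) ω ≠ ⊤ :=
    ae_all_iff.2 fun c => hX.ae_pointCount_ne_top (hD c) (hD' c)
  have hmeas : ∀ f : (C → ℕ) → ℝ≥0∞, AEMeasurable (fun ω => f (cellCount X D ω)) P := fun f =>
    (measurable_of_countable f).comp_aemeasurable (hX.aemeasurable_cellCount hD hD')
  have hR : ∫⁻ ω, F (fun l => config X univ ω (B l)) ∂P = ∫⁻ ω, g (cellCount X D ω) ∂P := by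
    refine lintegral_congr_ae ?_
    filter_upwards [hae] with ω hω
    simp_rw [hBD, g, config_univ_eq_cellCount hD hω]
  have hL : ∀ᵐ ω ∂P, ∑' i, ∑' j, ({i}ᶜ : Set ℕ).indicator (fun j =>
        (B a).indicator (fun _ => (1 : ℝ≥0∞)) (X i ω) * (B b).indicator (fun _ => 1) (X j ω) *
          F (fun l => config X {i, j}ᶜ ω (B l))) j
      = ∑ c ∈ S a, ∑ c' ∈ S b, cellCount X D ω c * (removeOne (cellCount X D ω) c c' *
          g (removeOne (removeOne (cellCount X D ω) c) c')) := by
    filter_upwards [hae] with ω hω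
    simp_rw [← tsum_pair_cell hD hdisj hω]
    simp_rw [← Summable.tsum_finsetSum (fun _ _ => ENNReal.summable)]
    refine tsum_congr fun i => tsum_congr fun j => ?_
    by_cases hij : j ∈ ({i}ᶜ : Set ℕ)
    · simp only [Set.indicator_of_mem hij]
      rw [indicator_eq_sum_cell hB hD hBD, indicator_eq_sum_cell hB hD hBD, Finset.sum_mul_sum,
        Finset.sum_mul]
      refine Finset.sum_congr rfl fun c _ => ?_
      rw [Finset.sum_mul]
      refine Finset.sum_congr rfl fun c' _ => ?_
      by_cases hi : X i ω ∈ D c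
      · by_cases hj : X j ω ∈ D c'
        · have hij' : i ≠ j := fun h => hij (by simp [h])
          simp_rw [hBD, g, config_compl_pair hD hdisj hω hij' hi hj]
        · simp [hj]
      · simp [hi]
    · simp [Set.indicator_of_notMem hij]
  rw [lintegral_congr_ae hL, hR, hBD _ a, hBD _ b,
    lintegral_finsetSum' _ fun c _ => Finset.aemeasurable_fun_sum _ fun c' _ =>
      hmeas fun n => n c * (removeOne n c c' * g (removeOne (removeOne n c) c'))]
  rw [Finset.mul_sum, Finset.mul_sum, Finset.sum_mul_sum, Finset.sum_mul]
  refine Finset.sum_congr rfl fun c _ => ?_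
  rw [Finset.sum_mul, lintegral_finsetSum' _ fun c' _ =>
      hmeas fun n => n c * (removeOne n c c' * g (removeOne (removeOne n c) c'))]
  refine Finset.sum_congr rfl fun c' _ => ?_
  rw [hX.lintegral_cellCount_mul hD hD' hdisj c (fun n => n c' * g (removeOne n c')),
    hX.lintegral_cellCount_mul hD hD' hdisj c' g]
  ring

end

section

/-! ### The Mecke formula for measurable functionals -/

variable {Ω : Type*} {d : ℕ} {X : ℕ → Ω → Space d}

/-- The `m`-th member of a partition of space into countably many Borel sets of finite volume. -/
def block (d m : ℕ) : Set (Space d) := disjointed (spanningSets (volume : Measure (Space d))) m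

lemma measurableSet_block (m : ℕ) : MeasurableSet (block d m) :=
  .disjointed (measurableSet_spanningSets _) m

lemma volume_block_ne_top (m : ℕ) : volume (block d m) ≠ ⊤ :=
  ne_top_of_le_ne_top (measure_spanningSets_lt_top volume m).ne
    (measure_mono (disjointed_subset _ _))

lemma iUnion_block : ⋃ m, block d m = univ := by
  simp only [block, iUnion_disjointed, iUnion_spanningSets]

lemma pairwise_disjoint_block : Pairwise fun m k => Disjoint (block d m) (block d k) :=
  disjoint_disjointed _

lemma sum_restrict_block (μ : Measure (Space d)) :
    Measure.sum (fun m => μ.restrict (block d m)) = μ := by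
  rw [← Measure.restrict_iUnion pairwise_disjoint_block measurableSet_block, iUnion_block,
    Measure.restrict_univ]

/-- A random measure is measurable once the masses of the sets of finite volume are. -/
lemma measurable_of_measurable_apply {β : Type*} [MeasurableSpace β] {f : β → Measure (Space d)}
    (hf : ∀ B, MeasurableSet B → volume B ≠ ⊤ → Measurable fun b => f b B) : Measurable f := by
  refine Measure.measurable_of_measurable_coe _ fun B hB => ?_
  have h : (fun b => f b B) = fun b => ∑' m, f b (B ∩ block d m) := by
    funext b
    conv_lhs => rw [← sum_restrict_block (f b)]
    rw [Measure.sum_apply _ hB]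
    simp_rw [Measure.restrict_apply hB]
  rw [h]
  exact Measurable.tsum fun m => hf _ (hB.inter (measurableSet_block m))
    (measure_ne_top_of_subset inter_subset_right (volume_block_ne_top m))

/-- The σ-algebra on configurations is generated by the masses of the sets of finite volume. -/
lemma measurableSpace_measure_eq_iSup :
    (Measure.instMeasurableSpace : MeasurableSpace (Measure (Space d)))
      = ⨆ B ∈ {B : Set (Space d) | MeasurableSet B ∧ volume B ≠ ⊤},
        (inferInstance : MeasurableSpace ℝ≥0∞).comap fun μ => μ B := by
  refine le_antisymm ?_ (iSup₂_le fun B hB => (Measure.measurable_coe hB.1).comap_le)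
  have h := @measurable_of_measurable_apply d (Measure (Space d))
    (⨆ B ∈ {B : Set (Space d) | MeasurableSet B ∧ volume B ≠ ⊤},
      (inferInstance : MeasurableSpace ℝ≥0∞).comap fun μ => μ B) id fun B hB hB' =>
        Measurable.of_comap_le (le_iSup₂_of_le B ⟨hB, hB'⟩ le_rfl)
  simpa using h.comap_le

/-- A π-system that generates the σ-algebra on configurations: the events that are determined by
the masses of finitely many sets of finite volume. -/
def countEvents (d : ℕ) : Set (Set (Measure (Space d))) :=
  piiUnionInter (fun B => {s | MeasurableSet[(inferInstance : MeasurableSpace ℝ≥0∞).comap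
    fun μ : Measure (Space d) => μ B] s}) {B : Set (Space d) | MeasurableSet B ∧ volume B ≠ ⊤}

lemma isPiSystem_countEvents : IsPiSystem (countEvents d) :=
  isPiSystem_piiUnionInter _ (fun _ => @MeasurableSpace.isPiSystem_measurableSet _ (_)) _

lemma generateFrom_countEvents :
    MeasurableSpace.generateFrom (countEvents d) = Measure.instMeasurableSpace := by
  rw [measurableSpace_measure_eq_iSup]
  exact generateFrom_piiUnionInter_measurableSet (fun B =>
    (inferInstance : MeasurableSpace ℝ≥0∞).comap fun μ : Measure (Space d) => μ B) _

/-- An event in `countEvents` is a condition on the masses of the members of a finite family of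
sets, and this family can be chosen to contain two prescribed sets. -/
lemma exists_family_of_mem_countEvents {E : Set (Measure (Space d))} (hE : E ∈ countEvents d)
    {A A' : Set (Space d)} (hA : MeasurableSet A) (hA' : MeasurableSet A')
    (hvA : volume A ≠ ⊤) (hvA' : volume A' ≠ ⊤) :
    ∃ (n : ℕ) (B : Fin n → Set (Space d)) (a b : Fin n) (V : Set (Fin n → ℝ≥0∞)),
      (∀ i, MeasurableSet (B i)) ∧ (∀ i, volume (B i) ≠ ⊤) ∧ B a = A ∧ B b = A' ∧
      ∀ μ, μ ∈ E ↔ (fun l => μ (B l)) ∈ V := by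
  obtain ⟨t, ht, f, hf, rfl⟩ := hE
  choose! V _ hV using hf
  let B' : Option (Option t) → Set (Space d) := fun o => o.elim A fun o' => o'.elim A' fun l => l
  let e := Fintype.equivFin (Option (Option t))
  refine ⟨_, B' ∘ e.symm, e none, e (some none),
    {v | ∀ l : t, v (e (some (some l))) ∈ V l}, ?_, ?_, by simp [B'], by simp [B'], ?_⟩
  · intro i
    rcases h : e.symm i with _ | _ | l
    · simpa [h, B'] using hA
    · simpa [h, B'] using hA'
    · simpa [h, B'] using (ht l.2).1
  · intro i
    rcases h : e.symm i with _ | _ | l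
    · simpa [h, B'] using hvA
    · simpa [h, B'] using hvA'
    · simpa [h, B'] using (ht l.2).2
  · intro μ
    simp only [mem_iInter, mem_ofPred_eq, Function.comp_apply, Equiv.symm_apply_apply, B',
      Option.elim_some, Subtype.forall]
    refine forall₂_congr fun l hl => ?_
    rw [← hV l hl]; rfl

variable [MeasurableSpace Ω] {P : Measure Ω} {lam : ℝ}

/-- The reduced Campbell measure: the intensity of pairs of a point and the configuration of the
other points. -/
def campbellOne (P : Measure Ω) (X : ℕ → Ω → Space d) : Measure (Space d × Measure (Space d)) :=
  Measure.sum fun i => P.map fun ω => (X i ω, config X {i}ᶜ ω)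

/-- The reduced Campbell measure of second order: the intensity of triples of two points with
distinct labels and the configuration of the other points. -/
def campbellTwo (P : Measure Ω) (X : ℕ → Ω → Space d) :
    Measure (Space d × Space d × Measure (Space d)) :=
  Measure.sum fun i => Measure.sum fun j =>
    ({i}ᶜ : Set ℕ).indicator (fun j => P.map fun ω => (X i ω, X j ω, config X {i, j}ᶜ ω)) j

lemma lintegral_campbellOne (hX : ∀ i, Measurable (X i))
    {Φ : Space d × Measure (Space d) → ℝ≥0∞} (hΦ : Measurable Φ) :
    ∫⁻ q, Φ q ∂(campbellOne P X) = ∑' i, ∫⁻ ω, Φ (X i ω, config X {i}ᶜ ω) ∂P := by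
  rw [campbellOne, lintegral_sum_measure]
  refine tsum_congr fun i => ?_
  rw [lintegral_map hΦ ((hX i).prodMk (measurable_config hX _))]

lemma lintegral_campbellTwo (hX : ∀ i, Measurable (X i))
    {Φ : Space d × Space d × Measure (Space d) → ℝ≥0∞} (hΦ : Measurable Φ) :
    ∫⁻ q, Φ q ∂(campbellTwo P X) = ∑' i, ∑' j, ({i}ᶜ : Set ℕ).indicator
      (fun j => ∫⁻ ω, Φ (X i ω, X j ω, config X {i, j}ᶜ ω) ∂P) j := by
  rw [campbellTwo, lintegral_sum_measure]
  refine tsum_congr fun i => ?_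
  rw [lintegral_sum_measure]
  refine tsum_congr fun j => ?_
  by_cases hj : j ∈ ({i}ᶜ : Set ℕ)
  · simp only [Set.indicator_of_mem hj]
    rw [lintegral_map hΦ ((hX i).prodMk ((hX j).prodMk (measurable_config hX _)))]
  · simp [Set.indicator_of_notMem hj]

lemma IsPoissonProcess.campbellOne_prod_of_mem_countEvents [IsProbabilityMeasure P]
    (hX : IsPoissonProcess P lam X) {A : Set (Space d)} (hA : MeasurableSet A)
    (hvA : volume A ≠ ⊤) {E : Set (Measure (Space d))} (hEm : MeasurableSet E)
    (hE : E ∈ countEvents d) :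
    campbellOne P X (A ×ˢ E)
      = ENNReal.ofReal lam * volume A * P.map (config X univ) E := by
  classical
  obtain ⟨n, B, a, b, V, hB, hB', rfl, -, hV⟩ :=
    exists_family_of_mem_countEvents hE hA hA hvA hvA
  have h := hX.mecke_one_of_cells (measurableSet_atomCell hB) (volume_atomCell_ne_top hB')
    (pairwise_disjoint_atomCell B) hB (fun μ i => measure_eq_sum_atomCell hB μ i) a (V.indicator 1)
  have hm : Measurable (indicator (B a ×ˢ E) (1 : Space d × Measure (Space d) → ℝ≥0∞)) :=
    measurable_one.indicator (hA.prod hEm)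
  have hm' : ∀ i, Measurable fun ω => indicator (B a ×ˢ E)
      (1 : Space d × Measure (Space d) → ℝ≥0∞) (X i ω, config X {i}ᶜ ω) := fun i =>
    hm.comp ((hX.measurable i).prodMk (measurable_config hX.measurable _))
  rw [← lintegral_indicator_one (hA.prod hEm), lintegral_campbellOne hX.measurable hm,
    ← lintegral_tsum fun i => (hm' i).aemeasurable,
    ← lintegral_indicator_one hEm,
    lintegral_map (measurable_one.indicator hEm) (measurable_config hX.measurable _)]
  have e1 : ∀ ω i, indicator (B a ×ˢ E) (1 : Space d × Measure (Space d) → ℝ≥0∞)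
      (X i ω, config X {i}ᶜ ω) = (B a).indicator (fun _ => (1 : ℝ≥0∞)) (X i ω) *
          V.indicator 1 (fun l => config X {i}ᶜ ω (B l)) := by
    intro ω i
    simp only [Set.indicator, mem_prod, ← hV]
    split_ifs <;> simp_all
  have e2 : ∀ ω, E.indicator (1 : Measure (Space d) → ℝ≥0∞) (config X univ ω)
      = V.indicator 1 (fun l => config X univ ω (B l)) := by
    intro ω
    simp only [Set.indicator, ← hV, Pi.one_apply]
  simp_rw [e1, e2]
  exact h

lemma IsPoissonProcess.campbellTwo_prod_of_mem_countEvents [IsProbabilityMeasure P]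
    (hX : IsPoissonProcess P lam X) {A A' : Set (Space d)} (hA : MeasurableSet A)
    (hA' : MeasurableSet A') (hvA : volume A ≠ ⊤) (hvA' : volume A' ≠ ⊤)
    {E : Set (Measure (Space d))} (hEm : MeasurableSet E) (hE : E ∈ countEvents d) :
    campbellTwo P X (A ×ˢ A' ×ˢ E) = ENNReal.ofReal lam * volume A *
      (ENNReal.ofReal lam * volume A') * P.map (config X univ) E := by
  classical
  obtain ⟨n, B, a, b, V, hB, hB', rfl, rfl, hV⟩ :=
    exists_family_of_mem_countEvents hE hA hA' hvA hvA'
  have h := hX.mecke_two_of_cells (measurableSet_atomCell hB) (volume_atomCell_ne_top hB')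
    (pairwise_disjoint_atomCell B) hB (fun μ i => measure_eq_sum_atomCell hB μ i) a b
    (V.indicator 1)
  have hm : Measurable (indicator (B a ×ˢ B b ×ˢ E)
        (1 : Space d × Space d × Measure (Space d) → ℝ≥0∞)) :=
    measurable_one.indicator (hA.prod (hA'.prod hEm))
  have hm' : ∀ i j, Measurable fun ω =>
      indicator (B a ×ˢ B b ×ˢ E)
        (1 : Space d × Space d × Measure (Space d) → ℝ≥0∞) (X i ω, X j ω, config X {i, j}ᶜ ω) :=
    fun i j =>
    hm.comp ((hX.measurable i).prodMk ((hX.measurable j).prodMk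
      (measurable_config hX.measurable _)))
  rw [← lintegral_indicator_one (hA.prod (hA'.prod hEm)), lintegral_campbellTwo hX.measurable hm,
    ← lintegral_indicator_one hEm,
    lintegral_map (measurable_one.indicator hEm) (measurable_config hX.measurable _)]
  have hswap : ∀ (f : ℕ → ℕ → Ω → ℝ≥0∞), (∀ i j, Measurable (f i j)) →
      ∑' i, ∑' j, ({i}ᶜ : Set ℕ).indicator (fun j => ∫⁻ ω, f i j ω ∂P) j
        = ∫⁻ ω, ∑' i, ∑' j, ({i}ᶜ : Set ℕ).indicator (fun j => f i j ω) j ∂P := by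
    intro f hf
    have hf' : ∀ i j, Measurable fun ω => ({i}ᶜ : Set ℕ).indicator (fun j => f i j ω) j := by
      intro i j
      by_cases hj : j ∈ ({i}ᶜ : Set ℕ)
      · simpa only [Set.indicator_of_mem hj] using hf i j
      · simp [Set.indicator_of_notMem hj]
    rw [lintegral_tsum fun i => (Measurable.tsum fun j => hf' i j).aemeasurable]
    refine tsum_congr fun i => ?_
    rw [lintegral_tsum fun j => (hf' i j).aemeasurable]
    refine tsum_congr fun j => ?_
    by_cases hj : j ∈ ({i}ᶜ : Set ℕ)
    · simp only [Set.indicator_of_mem hj]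
    · simp [Set.indicator_of_notMem hj]
  rw [hswap _ hm']
  have e1 : ∀ ω i j, indicator (B a ×ˢ B b ×ˢ E)
        (1 : Space d × Space d × Measure (Space d) → ℝ≥0∞) (X i ω, X j ω, config X {i, j}ᶜ ω)
      = (B a).indicator (fun _ => (1 : ℝ≥0∞)) (X i ω) * (B b).indicator (fun _ => 1) (X j ω) *
          V.indicator 1 (fun l => config X {i, j}ᶜ ω (B l)) := by
    intro ω i j
    simp only [Set.indicator, mem_prod, ← hV]
    split_ifs <;> simp_all
  have e2 : ∀ ω, E.indicator (1 : Measure (Space d) → ℝ≥0∞) (config X univ ω)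
      = V.indicator 1 (fun l => config X univ ω (B l)) := by
    intro ω
    simp only [Set.indicator, ← hV, Pi.one_apply]
  simp_rw [e1, e2]
  exact h

instance [IsProbabilityMeasure P] {f : Ω → Measure (Space d)} :
    IsFiniteMeasure (P.map f) := Measure.isFiniteMeasure_map P f

lemma univ_mem_countEvents : univ ∈ countEvents d :=
  ⟨∅, by simp, fun _ => univ, by simp, by simp⟩

lemma measurableSet_of_mem_countEvents {E : Set (Measure (Space d))} (hE : E ∈ countEvents d) :
    MeasurableSet E := by
  rw [← generateFrom_countEvents]
  exact MeasurableSpace.measurableSet_generateFrom hE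

lemma IsPoissonProcess.campbellOne_prod [IsProbabilityMeasure P]
    (hX : IsPoissonProcess P lam X) {A : Set (Space d)} (hA : MeasurableSet A)
    (hvA : volume A ≠ ⊤) {E : Set (Measure (Space d))} (hE : MeasurableSet E) :
    campbellOne P X (A ×ˢ E)
      = ENNReal.ofReal lam * volume A * P.map (config X univ) E := by
  have key : ∀ E, MeasurableSet E →
      ((campbellOne P X).restrict (A ×ˢ univ)).map Prod.snd E = campbellOne P X (A ×ˢ E) := by
    intro E hE
    rw [Measure.map_apply measurable_snd hE, Measure.restrict_apply (measurable_snd hE)]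
    congr 1
    ext ⟨x, η⟩; simp [and_comm]
  have hfin : (ENNReal.ofReal lam * volume A) ≠ ⊤ := ENNReal.mul_ne_top ENNReal.ofReal_ne_top hvA
  have hC : ∀ E ∈ countEvents d,
      ((ENNReal.ofReal lam * volume A) • P.map (config X univ)) E
        = ((campbellOne P X).restrict (A ×ˢ univ)).map Prod.snd E := by
    intro E hE
    have hEm := measurableSet_of_mem_countEvents hE
    rw [key E hEm, hX.campbellOne_prod_of_mem_countEvents hA hvA hEm hE]
    rfl
  have : IsFiniteMeasure ((ENNReal.ofReal lam * volume A) • P.map (config X univ)) :=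
    Measure.smul_finite _ hfin
  rw [← key E hE, ← ext_of_generate_finite _ generateFrom_countEvents.symm isPiSystem_countEvents hC
    (hC _ univ_mem_countEvents)]
  rfl

lemma IsPoissonProcess.campbellTwo_prod [IsProbabilityMeasure P]
    (hX : IsPoissonProcess P lam X) {A A' : Set (Space d)} (hA : MeasurableSet A)
    (hA' : MeasurableSet A') (hvA : volume A ≠ ⊤) (hvA' : volume A' ≠ ⊤)
    {E : Set (Measure (Space d))} (hE : MeasurableSet E) :
    campbellTwo P X (A ×ˢ A' ×ˢ E) = ENNReal.ofReal lam * volume A *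
      (ENNReal.ofReal lam * volume A') * P.map (config X univ) E := by
  have hs : Measurable fun q : Space d × Space d × Measure (Space d) => q.2.2 := by fun_prop
  have key : ∀ E, MeasurableSet E →
      ((campbellTwo P X).restrict (A ×ˢ A' ×ˢ univ)).map (fun q => q.2.2) E
        = campbellTwo P X (A ×ˢ A' ×ˢ E) := by
    intro E hE
    rw [Measure.map_apply hs hE, Measure.restrict_apply (hs hE)]
    congr 1
    ext ⟨x, y, η⟩; simp; tauto
  have hfin : ENNReal.ofReal lam * volume A * (ENNReal.ofReal lam * volume A') ≠ ⊤ := by finiteness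
  have hC : ∀ E ∈ countEvents d,
      ((ENNReal.ofReal lam * volume A * (ENNReal.ofReal lam * volume A')) •
          P.map (config X univ)) E
        = ((campbellTwo P X).restrict (A ×ˢ A' ×ˢ univ)).map (fun q => q.2.2) E := by
    intro E hE
    have hEm := measurableSet_of_mem_countEvents hE
    rw [key E hEm, hX.campbellTwo_prod_of_mem_countEvents hA hA' hvA hvA' hEm hE]
    rfl
  have : IsFiniteMeasure ((ENNReal.ofReal lam * volume A * (ENNReal.ofReal lam * volume A')) •
      P.map (config X univ)) := Measure.smul_finite _ hfin
  rw [← key E hE, ← ext_of_generate_finite _ generateFrom_countEvents.symm isPiSystem_countEvents hC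
    (hC _ univ_mem_countEvents)]
  rfl

/-- The univariate Mecke formula, for points in a set of finite volume. -/
theorem IsPoissonProcess.mecke_one [IsProbabilityMeasure P]
    (hX : IsPoissonProcess P lam X) {K : Set (Space d)} (hK : MeasurableSet K)
    (hvK : volume K ≠ ⊤) {Φ : Space d × Measure (Space d) → ℝ≥0∞} (hΦ : Measurable Φ) :
    ∑' i, ∫⁻ ω, K.indicator (fun x => Φ (x, config X {i}ᶜ ω)) (X i ω) ∂P
      = ENNReal.ofReal lam * ∫⁻ x in K, ∫⁻ ω, Φ (x, config X univ ω) ∂P := by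
  have hfin : volume K < ⊤ := hvK.lt_top
  have : IsFiniteMeasure (volume.restrict K) := ⟨by simpa using hfin⟩
  have hm := (measurable_config hX.measurable univ)
  have heq : ENNReal.ofReal lam • (volume.restrict K).prod (P.map (config X univ))
      = (campbellOne P X).restrict (K ×ˢ univ) := by
    have : IsFiniteMeasure
        (ENNReal.ofReal lam • (volume.restrict K).prod (P.map (config X univ))) :=
      Measure.smul_finite _ ENNReal.ofReal_ne_top
    refine Measure.ext_prod fun {s t} hs ht => ?_
    rw [Measure.restrict_apply (hs.prod ht), prod_inter_prod, inter_univ,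
      hX.campbellOne_prod (hs.inter hK)
        (measure_ne_top_of_subset inter_subset_right hvK) ht, Measure.smul_apply,
      Measure.prod_prod, Measure.restrict_apply hs, smul_eq_mul, mul_assoc]
  have h1 := lintegral_campbellOne (P := P) hX.measurable
    (hΦ.indicator (hK.prod (MeasurableSet.univ (α := Measure (Space d)))))
  rw [lintegral_indicator (hK.prod .univ), ← heq, lintegral_smul_measure,
    lintegral_prod _ hΦ.aemeasurable, smul_eq_mul] at h1
  have h2 : ∀ x, ∫⁻ q, Φ (x, q) ∂(P.map (config X univ)) = ∫⁻ ω, Φ (x, config X univ ω) ∂P := by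
    intro x
    rw [lintegral_map (by fun_prop) hm]
  simp_rw [h2] at h1
  rw [h1]
  refine tsum_congr fun i => lintegral_congr fun ω => ?_
  by_cases h : X i ω ∈ K <;> simp [h]

/-- The bivariate Mecke formula, for points in a set of finite volume. -/
theorem IsPoissonProcess.mecke_two [IsProbabilityMeasure P]
    (hX : IsPoissonProcess P lam X) {K : Set (Space d)} (hK : MeasurableSet K)
    (hvK : volume K ≠ ⊤) {Φ : Space d × Space d × Measure (Space d) → ℝ≥0∞} (hΦ : Measurable Φ) :
    ∑' i, ∑' j, ({i}ᶜ : Set ℕ).indicator (fun j => ∫⁻ ω,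
        (K ×ˢ K).indicator (fun p => Φ (p.1, p.2, config X {i, j}ᶜ ω)) (X i ω, X j ω) ∂P) j
      = ENNReal.ofReal lam * ENNReal.ofReal lam *
        ∫⁻ x in K, ∫⁻ y in K, ∫⁻ ω, Φ (x, y, config X univ ω) ∂P := by
  have hfin : volume K < ⊤ := hvK.lt_top
  have : IsFiniteMeasure (volume.restrict K) := ⟨by simpa using hfin⟩
  have hm := (measurable_config hX.measurable univ)
  have heq : (ENNReal.ofReal lam * ENNReal.ofReal lam) •
        (volume.restrict K).prod ((volume.restrict K).prod (P.map (config X univ)))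
      = (campbellTwo P X).restrict (K ×ˢ K ×ˢ univ) := by
    have : IsFiniteMeasure ((ENNReal.ofReal lam * ENNReal.ofReal lam) •
        (volume.restrict K).prod ((volume.restrict K).prod (P.map (config X univ)))) :=
      Measure.smul_finite _ (by finiteness)
    refine Measure.ext_prod₃ fun {s t u} hs ht hu => ?_
    rw [Measure.restrict_apply (hs.prod (ht.prod hu)), prod_inter_prod, prod_inter_prod, inter_univ,
      hX.campbellTwo_prod (hs.inter hK) (ht.inter hK)
        (measure_ne_top_of_subset inter_subset_right hvK)
        (measure_ne_top_of_subset inter_subset_right hvK) hu, Measure.smul_apply,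
      Measure.prod_prod, Measure.prod_prod, Measure.restrict_apply hs, Measure.restrict_apply ht,
      smul_eq_mul]
    ring
  have h1 := lintegral_campbellTwo (P := P) hX.measurable
    (hΦ.indicator (hK.prod (hK.prod (MeasurableSet.univ (α := Measure (Space d))))))
  rw [lintegral_indicator (hK.prod (hK.prod .univ)), ← heq, lintegral_smul_measure,
    lintegral_prod _ hΦ.aemeasurable, smul_eq_mul] at h1
  have h2 : ∀ x, ∫⁻ q, Φ (x, q) ∂((volume.restrict K).prod (P.map (config X univ)))
      = ∫⁻ y in K, ∫⁻ ω, Φ (x, y, config X univ ω) ∂P := by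
    intro x
    rw [lintegral_prod _ (by fun_prop)]
    refine lintegral_congr fun y => ?_
    rw [lintegral_map (by fun_prop) hm]
  simp_rw [h2] at h1
  rw [h1]
  refine tsum_congr fun i => tsum_congr fun j => ?_
  congr 1
  funext j
  refine lintegral_congr fun ω => ?_
  by_cases h : X i ω ∈ K <;> by_cases h' : X j ω ∈ K <;> simp [h, h']

end

section

/-! ### The Laplace functional of a Poisson process -/

variable {Ω : Type*} {d : ℕ} {X : ℕ → Ω → Space d}
variable [MeasurableSpace Ω] {P : Measure Ω} {lam : ℝ}

/-- The Laplace functional for functions that are constant on finitely many cells. -/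
lemma IsPoissonProcess.laplace_cells [IsProbabilityMeasure P] (hX : IsPoissonProcess P lam X)
    {C : Type*} [Fintype C] {D : C → Set (Space d)}
    (hD : ∀ c, MeasurableSet (D c)) (hD' : ∀ c, volume (D c) ≠ ⊤)
    (hdisj : Pairwise fun c c' => Disjoint (D c) (D c')) (a : C → ℝ≥0∞) :
    ∫⁻ ω, expNeg (∑ c, a c * config X univ ω (D c)) ∂P
      = expNeg (ENNReal.ofReal lam * ∑ c, (1 - expNeg (a c)) * volume (D c)) := by
  have hae : ∀ᵐ ω ∂P, ∀ c, pointCount X (D c) ω ≠ ⊤ :=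
    ae_all_iff.2 fun c => hX.ae_pointCount_ne_top (hD c) (hD' c)
  have h1 : ∫⁻ ω, expNeg (∑ c, a c * config X univ ω (D c)) ∂P
      = ∫⁻ ω, (fun n : C → ℕ => ∏ c, expNeg (n c * a c)) (cellCount X D ω) ∂P := by
    refine lintegral_congr_ae ?_
    filter_upwards [hae] with ω hω
    simp_rw [config_univ_eq_cellCount hD hω, expNeg_sum, mul_comm]
  rw [h1, ← lintegral_map' (f := fun n : C → ℕ => ∏ c, expNeg (n c * a c))
    (measurable_of_countable _).aemeasurable (hX.aemeasurable_cellCount hD hD'),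
    hX.map_cellCount hD hD' hdisj]
  set r := fun c => Real.toNNReal (lam * (volume (D c)).toReal)
  have hind : iIndepFun (fun c (n : C → ℕ) => expNeg (n c * a c))
      (Measure.pi fun c => poissonMeasure (r c)) :=
    iIndepFun_pi (X := fun c (k : ℕ) => expNeg (k * a c)) fun c => by fun_prop
  rw [lintegral_prod_eq_prod_lintegral_of_indepFun _ _ hind (fun c => measurable_of_countable _),
    Finset.mul_sum, expNeg_sum]
  refine Finset.prod_congr rfl fun c _ => ?_
  have h2 := (measurePreserving_eval (fun c => poissonMeasure (r c)) c).lintegral_comp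
    (f := fun k : ℕ => expNeg (k * a c)) (measurable_of_countable _)
  simp only [Function.eval] at h2
  rw [h2, lintegral_expNeg_poissonMeasure]
  congr 1
  have hr : ENNReal.ofReal lam * volume (D c) = (r c : ℝ≥0∞) := by
    conv_lhs => rw [← ENNReal.ofReal_toReal (hD' c)]
    rw [← ENNReal.ofReal_mul' ENNReal.toReal_nonneg]
    rfl
  rw [← hr]; ring

lemma IsPoissonProcess.laplace_simpleFunc [IsProbabilityMeasure P]
    (hX : IsPoissonProcess P lam X) (f : SimpleFunc (Space d) ℝ≥0∞) {W : Set (Space d)}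
    (hW : MeasurableSet W) (hvW : volume W ≠ ⊤) :
    ∫⁻ ω, expNeg (∫⁻ z in W, f z ∂(config X univ ω)) ∂P
      = expNeg (ENNReal.ofReal lam * ∫⁻ z in W, (1 - expNeg (f z))) := by
  have h := hX.laplace_cells (C := f.range) (D := fun c => f ⁻¹' {c.1} ∩ W)
    (fun c => (f.measurableSet_fiber _).inter hW)
    (fun c => measure_ne_top_of_subset inter_subset_right hvW)
    (fun c c' hcc => by
      refine Set.disjoint_left.2 ?_
      rintro z ⟨h1, -⟩ ⟨h2, -⟩
      exact hcc (Subtype.ext (h1.symm.trans h2))) (fun c => c.1)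
  have e1 : ∀ η : Measure (Space d), ∫⁻ z in W, f z ∂η
      = ∑ c : f.range, c.1 * η (f ⁻¹' {c.1} ∩ W) := by
    intro η
    rw [SimpleFunc.lintegral_eq_lintegral, SimpleFunc.lintegral,
      ← Finset.sum_coe_sort f.range]
    simp_rw [Measure.restrict_apply (f.measurableSet_fiber _)]
  have e2 : ∫⁻ z in W, (1 - expNeg (f z))
      = ∑ c : f.range, (1 - expNeg c.1) * volume (f ⁻¹' {c.1} ∩ W) := by
    have := SimpleFunc.lintegral_eq_lintegral (f.map fun a => 1 - expNeg a) (volume.restrict W)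
    rw [SimpleFunc.map_lintegral, ← Finset.sum_coe_sort f.range] at this
    simp_rw [Measure.restrict_apply (f.measurableSet_fiber _)] at this
    exact this
  simp_rw [e1]
  rw [h, e2]

/-- The Laplace functional of a Poisson process. -/
theorem IsPoissonProcess.laplace [IsProbabilityMeasure P] (hX : IsPoissonProcess P lam X)
    {ψ : Space d → ℝ≥0∞} (hψ : Measurable ψ) :
    ∫⁻ ω, expNeg (∫⁻ z, ψ z ∂(config X univ ω)) ∂P
      = expNeg (ENNReal.ofReal lam * ∫⁻ z, (1 - expNeg (ψ z))) := by
  -- Simple functions supported by sets of finite volume increase to `ψ`.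
  let W := spanningSets (volume : Measure (Space d))
  let f := SimpleFunc.eapprox ψ
  let F : ℕ → Space d → ℝ≥0∞ := fun m => (W m).indicator (f m)
  have hWm : ∀ m, MeasurableSet (W m) := measurableSet_spanningSets _
  have hFm : ∀ m, Measurable (F m) := fun m => (f m).measurable.indicator (hWm m)
  have hFmono : ∀ z, Monotone fun m => F m z := by
    intro z m k hmk
    refine (Set.indicator_le_indicator_of_subset (monotone_spanningSets _ hmk)
      (fun _ => zero_le) z).trans ?_
    exact Set.indicator_le_indicator (SimpleFunc.monotone_eapprox ψ hmk z)
  have hFlim : ∀ z, Tendsto (fun m => F m z) atTop (𝓝 (ψ z)) := by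
    intro z
    refine (SimpleFunc.tendsto_eapprox hψ z).congr' ?_
    filter_upwards [eventually_ge_atTop (spanningSetsIndex volume z)] with m hm
    have : z ∈ W m := monotone_spanningSets _ hm (mem_spanningSetsIndex volume z)
    simp [F, f, this]
  have hint : ∀ η : Measure (Space d), Tendsto (fun m => ∫⁻ z, F m z ∂η) atTop
      (𝓝 (∫⁻ z, ψ z ∂η)) := fun η =>
    lintegral_tendsto_of_tendsto_of_monotone (fun m => (hFm m).aemeasurable)
      (ae_of_all _ hFmono) (ae_of_all _ hFlim)
  have hL : Tendsto (fun m => ∫⁻ ω, expNeg (∫⁻ z, F m z ∂(config X univ ω)) ∂P) atTop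
      (𝓝 (∫⁻ ω, expNeg (∫⁻ z, ψ z ∂(config X univ ω)) ∂P)) := by
    refine tendsto_lintegral_of_dominated_convergence (fun _ => 1) (fun m => ?_)
      (fun m => ae_of_all _ fun ω => expNeg_le_one _) (by simp) (ae_of_all _ fun ω => ?_)
    · exact measurable_expNeg.comp ((Measure.measurable_lintegral (hFm m)).comp
        (measurable_config hX.measurable _))
    · exact (continuous_expNeg.tendsto _).comp (hint _)
  have hR : Tendsto (fun m => expNeg (ENNReal.ofReal lam * ∫⁻ z, (1 - expNeg (F m z)))) atTop
      (𝓝 (expNeg (ENNReal.ofReal lam * ∫⁻ z, (1 - expNeg (ψ z))))) := by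
    refine (continuous_expNeg.tendsto _).comp ?_
    refine ENNReal.Tendsto.const_mul ?_ (Or.inr ENNReal.ofReal_ne_top)
    refine lintegral_tendsto_of_tendsto_of_monotone (fun m => by fun_prop) ?_ ?_
    · exact ae_of_all _ fun z m k hmk => tsub_le_tsub_left (antitone_expNeg (hFmono z hmk)) _
    · refine ae_of_all _ fun z => ?_
      exact ENNReal.Tendsto.sub tendsto_const_nhds ((continuous_expNeg.tendsto _).comp (hFlim z))
        (Or.inl ENNReal.one_ne_top)
  refine tendsto_nhds_unique hL (hR.congr fun m => ?_)
  have h := hX.laplace_simpleFunc (f m) (hWm m) (measure_spanningSets_lt_top volume m).ne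
  simp_rw [F, lintegral_indicator (hWm m)]
  rw [h, ← lintegral_indicator (hWm m)]
  congr 3
  funext z
  by_cases hz : z ∈ W m <;> simp [hz]

/-! ### Exponential functionals of the configuration -/

lemma measurable_restrict_block_or_zero (m N : ℕ) : Measurable fun η : Measure (Space d) =>
    if η (block d m) ∈ Ico (N : ℝ≥0∞) (N + 1) then η.restrict (block d m) else 0 :=
  Measurable.ite (Measure.measurable_coe (measurableSet_block m) measurableSet_Ico)
    (Measure.measurable_of_measurable_coe _ fun B hB => by
      simp_rw [Measure.restrict_apply hB]
      exact Measure.measurable_coe (hB.inter (measurableSet_block m))) measurable_const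

/-- The identity kernel from configurations to space, which sends `η` to `η`, modified so as to be
s-finite: the blocks of infinite mass are discarded. -/
def configKernel (d : ℕ) : Kernel (Measure (Space d)) (Space d) :=
  Kernel.sum fun p : ℕ × ℕ =>
    { toFun := fun η =>
        if η (block d p.1) ∈ Ico (p.2 : ℝ≥0∞) (p.2 + 1) then η.restrict (block d p.1) else 0
      measurable' := measurable_restrict_block_or_zero p.1 p.2 }

instance isSFiniteKernel_configKernel : IsSFiniteKernel (configKernel d) := by
  unfold configKernel
  refine @Kernel.isSFiniteKernel_sum _ _ _ _ _ _ _ fun p => ?_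
  refine @Kernel.IsFiniteKernel.isSFiniteKernel _ _ _ _ _ ⟨p.2 + 1, by finiteness, fun η => ?_⟩
  change (if η (block d p.1) ∈ Ico (p.2 : ℝ≥0∞) (p.2 + 1) then η.restrict (block d p.1) else 0)
    univ ≤ _
  split_ifs with h
  · simpa using h.2.le
  · simp

lemma configKernel_apply {η : Measure (Space d)} (hη : ∀ m, η (block d m) ≠ ⊤) :
    configKernel d η = η := by
  have h1 : configKernel d η = Measure.sum fun m => Measure.sum fun N : ℕ =>
      if η (block d m) ∈ Ico (N : ℝ≥0∞) (N + 1) then η.restrict (block d m) else 0 := by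
    rw [Measure.sum_sum]; rfl
  conv_rhs => rw [← sum_restrict_block η]
  rw [h1]
  congr 1
  funext m
  ext B hB
  set r := (η (block d m)).toNNReal with hr
  have hrη : η (block d m) = r := (ENNReal.coe_toNNReal (hη m)).symm
  rw [Measure.sum_apply _ hB, tsum_eq_single ⌊r⌋₊]
  · rw [if_pos]
    rw [hrη]
    exact ⟨by exact_mod_cast Nat.floor_le (zero_le : 0 ≤ r),
      by exact_mod_cast Nat.lt_floor_add_one r⟩
  · intro N hN
    rw [if_neg]
    · simp
    · rw [hrη]
      rintro ⟨h2, h3⟩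
      refine hN ((Nat.floor_eq_iff (zero_le : 0 ≤ r)).2 ⟨?_, ?_⟩).symm
      · exact_mod_cast h2
      · exact_mod_cast h3

lemma IsPoissonProcess.ae_configKernel_config (hX : IsPoissonProcess P lam X) :
    ∀ᵐ ω ∂P, ∀ T, configKernel d (config X T ω) = config X T ω := by
  have hae : ∀ᵐ ω ∂P, ∀ m, pointCount X (block d m) ω ≠ ⊤ :=
    ae_all_iff.2 fun m => hX.ae_pointCount_ne_top (measurableSet_block m) (volume_block_ne_top m)
  filter_upwards [hae] with ω hω T
  refine configKernel_apply fun m => ?_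
  have h : config X univ ω (block d m) ≠ ⊤ := by
    rw [config_univ_apply X ω (measurableSet_block m)]
    simpa using hω m
  refine ne_top_of_le_ne_top h ?_
  rw [config_apply _ _ _ (measurableSet_block m), config_apply _ _ _ (measurableSet_block m)]
  have h2 : {k | X k ω ∈ block d m ∧ k ∈ T} ⊆ {k | X k ω ∈ block d m ∧ k ∈ univ} :=
    fun k hk => ⟨hk.1, mem_univ _⟩
  exact_mod_cast Set.encard_le_encard h2

/-- Integration against the configuration is jointly measurable. This is the purpose of
`configKernel`: joint measurability is available for integrals against s-finite kernels only. -/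
lemma measurable_lintegral_configKernel {α : Type*} [MeasurableSpace α] {ψ : α × Space d → ℝ≥0∞}
    (hψ : Measurable ψ) :
    Measurable fun q : α × Measure (Space d) => ∫⁻ z, ψ (q.1, z) ∂(configKernel d q.2) := by
  have : Measurable fun q : (α × Measure (Space d)) × Space d => ψ (q.1.1, q.2) := by fun_prop
  exact this.lintegral_kernel_prod_right' (κ := (configKernel d).comap Prod.snd measurable_snd)

/-- The expected number of points in `K`, weighted by an exponential functional of the
configuration seen from the point. -/
theorem IsPoissonProcess.tsum_lintegral_expNeg_one [IsProbabilityMeasure P]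
    (hX : IsPoissonProcess P lam X) {K : Set (Space d)} (hK : MeasurableSet K)
    (hvK : volume K ≠ ⊤) {ψ : Space d → Space d → ℝ≥0∞} (hψ : Measurable (Function.uncurry ψ)) :
    ∑' i, ∫⁻ ω, K.indicator (fun x => expNeg (∑' k, ({i}ᶜ : Set ℕ).indicator
        (fun k => ψ x (X k ω)) k)) (X i ω) ∂P
      = ENNReal.ofReal lam * ∫⁻ x in K,
          expNeg (ENNReal.ofReal lam * ∫⁻ z, (1 - expNeg (ψ x z))) := by
  have hψ' : ∀ x, Measurable (ψ x) := fun x => hψ.comp measurable_prodMk_left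
  have h := hX.mecke_one hK hvK
    (Φ := fun q => expNeg (∫⁻ z, Function.uncurry ψ (q.1, z) ∂(configKernel d q.2)))
    (measurable_expNeg.comp (measurable_lintegral_configKernel hψ))
  have hker := hX.ae_configKernel_config
  convert h using 1
  · refine tsum_congr fun i => lintegral_congr_ae ?_
    filter_upwards [hker] with ω hω
    by_cases hi : X i ω ∈ K
    · simp only [Set.indicator_of_mem hi, hω]
      exact congrArg expNeg (lintegral_config _ _ _ (hψ' (X i ω))).symm
    · simp only [Set.indicator_of_notMem hi]
  · congr 1
    refine lintegral_congr fun x => ?_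
    rw [← hX.laplace (hψ' x)]
    refine lintegral_congr_ae ?_
    filter_upwards [hker] with ω hω
    simp only [hω]
    rfl

/-- The expected number of ordered pairs of points in `K`, weighted by a function of the pair and
an exponential functional of the configuration seen from the pair. -/
theorem IsPoissonProcess.tsum_lintegral_expNeg_two [IsProbabilityMeasure P]
    (hX : IsPoissonProcess P lam X) {K : Set (Space d)} (hK : MeasurableSet K)
    (hvK : volume K ≠ ⊤) {w : Space d × Space d → ℝ≥0∞} (hw : Measurable w)
    {ψ : Space d × Space d → Space d → ℝ≥0∞} (hψ : Measurable (Function.uncurry ψ)) :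
    ∑' i, ∑' j, ({i}ᶜ : Set ℕ).indicator (fun j => ∫⁻ ω, (K ×ˢ K).indicator (fun p =>
        w p * expNeg (∑' k, ({i, j}ᶜ : Set ℕ).indicator (fun k => ψ p (X k ω)) k))
          (X i ω, X j ω) ∂P) j
      = ENNReal.ofReal lam * ENNReal.ofReal lam * ∫⁻ x in K, ∫⁻ y in K,
          w (x, y) * expNeg (ENNReal.ofReal lam * ∫⁻ z, (1 - expNeg (ψ (x, y) z))) := by
  have hψ' : ∀ p, Measurable (ψ p) := fun p => hψ.comp measurable_prodMk_left
  let J : (Space d × Space d) × Measure (Space d) → ℝ≥0∞ := fun q =>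
    expNeg (∫⁻ z, ψ q.1 z ∂(configKernel d q.2))
  have hJ : Measurable J := measurable_expNeg.comp (measurable_lintegral_configKernel hψ)
  have hg : Measurable fun q : Space d × Space d × Measure (Space d) =>
      ((q.1, q.2.1), q.2.2) := by fun_prop
  have hg' : Measurable fun q : Space d × Space d × Measure (Space d) => w (q.1, q.2.1) := by
    fun_prop
  have h := hX.mecke_two hK hvK (hg'.mul (hJ.comp hg))
  have hker := hX.ae_configKernel_config
  refine Eq.trans ?_ (h.trans ?_)
  · refine tsum_congr fun i => tsum_congr fun j => ?_
    refine congrArg (fun f => indicator _ f j) (funext fun j => lintegral_congr_ae ?_)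
    filter_upwards [hker] with ω hω
    by_cases hi : (X i ω, X j ω) ∈ K ×ˢ K
    · rw [Set.indicator_of_mem hi, Set.indicator_of_mem hi]
      simp only [Pi.mul_apply, Function.comp_apply, J, hω, lintegral_config _ _ _ (hψ' _)]
    · rw [Set.indicator_of_notMem hi, Set.indicator_of_notMem hi]
  · congr 1
    refine lintegral_congr fun x => lintegral_congr fun y => ?_
    have hm : Measurable fun ω => expNeg (∫⁻ z, ψ (x, y) z ∂(config X univ ω)) :=
      measurable_expNeg.comp
        ((Measure.measurable_lintegral (hψ' (x, y))).comp (measurable_config hX.measurable _))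
    rw [← hX.laplace (hψ' (x, y)), ← lintegral_const_mul _ hm]
    refine lintegral_congr_ae ?_
    filter_upwards [hker] with ω hω
    simp only [Pi.mul_apply, Function.comp_apply, J, hω]

end

section

/-! ### Isolation and the marks -/

variable {Ω : Type*} {d : ℕ} {X : ℕ → Ω → Space d} {U : Sym2 ℕ → Ω → ℝ}

/-- Isolation of `i` means that all the marks of the pairs at `i` are above their thresholds. -/
lemma graph_isIsolated_iff (h : ℝ → ℝ) (ω : Ω) (i : ℕ) :
    (graph X U h ω).IsIsolated i ↔ ∀ k, k ≠ i → h (dist (X i ω) (X k ω)) ≤ U s(i, k) ω := by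
  simp only [SimpleGraph.IsIsolated, graph, not_and, not_lt]
  exact forall_congr' fun k => ⟨fun hk hki => hk hki.symm, fun hk hki => hk hki.symm⟩

/-- The event that the point with label `i` lies in `K` and is isolated. -/
def isolatedEvent (X : ℕ → Ω → Space d) (U : Sym2 ℕ → Ω → ℝ) (h : ℝ → ℝ) (K : Set (Space d))
    (i : ℕ) : Set Ω := {ω | X i ω ∈ K ∧ (graph X U h ω).IsIsolated i}

/-- The event of isolation in terms of the sequence of points and the family of marks. -/
def isolatedPairs (h : ℝ → ℝ) (K : Set (Space d)) (i : ℕ) :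
    Set ((ℕ → Space d) × (Sym2 ℕ → ℝ)) :=
  {q | q.1 i ∈ K ∧ ∀ k, k ≠ i → h (dist (q.1 i) (q.1 k)) ≤ q.2 s(i, k)}

lemma isolatedEvent_eq_preimage (h : ℝ → ℝ) (K : Set (Space d)) (i : ℕ) :
    isolatedEvent X U h K i
      = (fun ω => ((fun i => X i ω : ℕ → Space d), (fun e => U e ω : Sym2 ℕ → ℝ))) ⁻¹'
        isolatedPairs h K i := by
  ext ω
  simp only [isolatedEvent, isolatedPairs, graph_isIsolated_iff]
  rfl

variable [MeasurableSpace Ω] {P : Measure Ω} {lam : ℝ}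

/-- The probability that all members of a countable family of independent uniform marks exceed
prescribed thresholds. -/
lemma measure_forall_le_mark {ι : Type*} [Countable ι] [IsProbabilityMeasure P]
    {V : ι → Ω → ℝ} (hVm : ∀ a, Measurable (V a))
    (hV : ∀ a, HasLaw (V a) (volume.restrict (Icc (0 : ℝ) 1)) P)
    (hind : iIndepFun V P) {t : ι → ℝ} (ht : ∀ a, t a ∈ Icc (0 : ℝ) 1) :
    P {ω | ∀ a, t a ≤ V a ω} = expNeg (∑' a, negLog (ENNReal.ofReal (1 - t a))) := by
  have hsingle : ∀ a, P (V a ⁻¹' Ici (t a)) = expNeg (negLog (ENNReal.ofReal (1 - t a))) := by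
    intro a
    rw [expNeg_negLog (by simpa using (ht a).1), ← Measure.map_apply (hVm a) measurableSet_Ici,
      (hV a).map_eq, Measure.restrict_apply measurableSet_Ici]
    have : Ici (t a) ∩ Icc 0 1 = Icc (t a) 1 := by
      ext r
      have := (ht a).1
      simp only [mem_inter_iff, mem_Ici, mem_Icc]
      constructor
      · rintro ⟨h1, -, h3⟩; exact ⟨h1, h3⟩
      · rintro ⟨h1, h3⟩; exact ⟨h1, this.trans h1, h3⟩
    rw [this, Real.volume_Icc]
  let s : Finset ι → Set Ω := fun S => ⋂ a ∈ S, V a ⁻¹' Ici (t a)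
  have hs : ∀ S, P (s S) = expNeg (∑ a ∈ S, negLog (ENNReal.ofReal (1 - t a))) := by
    intro S
    rw [hind.measure_inter_preimage_eq_mul S (fun a _ => measurableSet_Ici), expNeg_sum]
    exact Finset.prod_congr rfl fun a _ => hsingle a
  have hsm : ∀ S, MeasurableSet (s S) := fun S =>
    Finset.measurableSet_biInter S fun a _ => hVm a measurableSet_Ici
  have hlim := tendsto_measure_iInter_atTop (μ := P) (s := s) (fun S => (hsm S).nullMeasurableSet)
    (fun S T hST => biInter_subset_biInter_left hST) ⟨∅, measure_ne_top _ _⟩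
  have hset : ⋂ S, s S = {ω | ∀ a, t a ≤ V a ω} := by
    ext ω
    simp only [s, mem_iInter, mem_preimage, mem_Ici, mem_ofPred_eq]
    exact ⟨fun h a => h {a} a (by simp), fun h S a _ => h a⟩
  rw [hset] at hlim
  refine tendsto_nhds_unique hlim ?_
  have : P ∘ s = fun S => expNeg (∑ a ∈ S, negLog (ENNReal.ofReal (1 - t a))) := funext hs
  rw [this]
  exact (continuous_expNeg.tendsto _).comp ENNReal.summable.hasSum

/-- A measurable function of the distance with values in `[0, 1]` on `[0, ∞)`. This is what is
needed of a connection function apart from its integrability. -/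
structure IsProfile (h : ℝ → ℝ) : Prop where
  measurable : Measurable h
  mem_Icc : ∀ r : ℝ, 0 ≤ r → h r ∈ Icc (0 : ℝ) 1

lemma IsProfile.dist_mem {h : ℝ → ℝ} (hh : IsProfile h) (x z : Space d) :
    h (dist x z) ∈ Icc (0 : ℝ) 1 := hh.mem_Icc _ dist_nonneg

lemma IsProfile.measurable_dist {h : ℝ → ℝ} (hh : IsProfile h) :
    Measurable fun p : Space d × Space d => h (dist p.1 p.2) :=
  hh.measurable.comp (by fun_prop)

/-- The cost `-log (1 - h(|x - z|))` of the absence of an edge between `x` and `z`. -/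
def edgeCost (h : ℝ → ℝ) (x z : Space d) : ℝ≥0∞ := negLog (ENNReal.ofReal (1 - h (dist x z)))

lemma IsProfile.expNeg_edgeCost {h : ℝ → ℝ} (hh : IsProfile h) (x z : Space d) :
    expNeg (edgeCost h x z) = ENNReal.ofReal (1 - h (dist x z)) :=
  expNeg_negLog (by simpa using (hh.dist_mem x z).1)

lemma IsProfile.measurable_edgeCost {h : ℝ → ℝ} (hh : IsProfile h) :
    Measurable (Function.uncurry (edgeCost (d := d) h)) :=
  measurable_negLog.comp (ENNReal.measurable_ofReal.comp
    (measurable_const.sub hh.measurable_dist))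

lemma IsProfile.measurableSet_isolatedPairs {h : ℝ → ℝ} (hh : IsProfile h) {K : Set (Space d)}
    (hK : MeasurableSet K) (i : ℕ) : MeasurableSet (isolatedPairs h K i) := by
  have h1 : isolatedPairs h K i = {q : (ℕ → Space d) × (Sym2 ℕ → ℝ) | q.1 i ∈ K} ∩
      ⋂ k, {q | k ≠ i → h (dist (q.1 i) (q.1 k)) ≤ q.2 s(i, k)} := by
    ext q; simp [isolatedPairs]
  have hev : ∀ k, Measurable fun q : (ℕ → Space d) × (Sym2 ℕ → ℝ) => q.1 k := fun k =>
    (measurable_pi_apply k).comp measurable_fst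
  have hev' : ∀ e, Measurable fun q : (ℕ → Space d) × (Sym2 ℕ → ℝ) => q.2 e := fun e =>
    (measurable_pi_apply e).comp measurable_snd
  rw [h1]
  refine (hev i hK).inter (MeasurableSet.iInter fun k => ?_)
  by_cases hk : k = i
  · simp [hk]
  · simp only [ne_eq, hk, not_false_eq_true, forall_const]
    exact measurableSet_le (hh.measurable.comp ((hev i).dist (hev k))) (hev' _)

lemma IsMarkedPoissonProcess.measurableSet_isolatedEvent (hXU : IsMarkedPoissonProcess P lam X U)
    {h : ℝ → ℝ} (hh : IsProfile h) {K : Set (Space d)} (hK : MeasurableSet K) (i : ℕ) :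
    MeasurableSet (isolatedEvent X U h K i) := by
  rw [isolatedEvent_eq_preimage]
  exact (Measurable.prodMk (measurable_pi_lambda _ hXU.poisson.measurable)
    (measurable_pi_lambda _ hXU.measurable_mark)) (hh.measurableSet_isolatedPairs hK i)

/-- Events that depend on the points and the marks can be computed by first averaging over the
marks. -/
lemma IsMarkedPoissonProcess.measure_preimage [IsProbabilityMeasure P]
    (hXU : IsMarkedPoissonProcess P lam X U) {S : Set ((ℕ → Space d) × (Sym2 ℕ → ℝ))}
    (hS : MeasurableSet S) :
    P ((fun ω => ((fun i => X i ω : ℕ → Space d), (fun e => U e ω : Sym2 ℕ → ℝ))) ⁻¹' S)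
      = ∫⁻ ω, P {ω' | ((fun i => X i ω), (fun e => U e ω')) ∈ S} ∂P := by
  have hmX : Measurable fun ω i => X i ω := measurable_pi_lambda _ hXU.poisson.measurable
  have hmU : Measurable fun ω e => U e ω := measurable_pi_lambda _ hXU.measurable_mark
  have := Measure.isProbabilityMeasure_map (μ := P) hmX.aemeasurable
  have := Measure.isProbabilityMeasure_map (μ := P) hmU.aemeasurable
  rw [← Measure.map_apply (hmX.prodMk hmU) hS,
    (indepFun_iff_map_prod_eq_prod_map_map hmX.aemeasurable hmU.aemeasurable).1
      hXU.indep_points_marks, Measure.prod_apply hS,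
    lintegral_map (measurable_measure_prodMk_left hS) hmX]
  refine lintegral_congr fun ω => ?_
  rw [Measure.map_apply hmU (measurable_prodMk_left hS)]
  rfl

/-- The probability of isolation as an exponential functional of the other points. -/
lemma IsMarkedPoissonProcess.measure_isolatedEvent [IsProbabilityMeasure P]
    (hXU : IsMarkedPoissonProcess P lam X U) {h : ℝ → ℝ} (hh : IsProfile h) {K : Set (Space d)}
    (hK : MeasurableSet K) (i : ℕ) :
    P (isolatedEvent X U h K i) = ∫⁻ ω, K.indicator (fun x => expNeg (∑' k,
      ({i}ᶜ : Set ℕ).indicator (fun k => edgeCost h x (X k ω)) k)) (X i ω) ∂P := by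
  rw [isolatedEvent_eq_preimage, hXU.measure_preimage (hh.measurableSet_isolatedPairs hK i)]
  refine lintegral_congr fun ω => ?_
  by_cases hi : X i ω ∈ K
  · rw [Set.indicator_of_mem hi]
    -- The pairs at `i` are distinct, so their marks form an independent family.
    let e : ({i}ᶜ : Set ℕ) → Sym2 ℕ := fun k => s(i, k)
    have he : Function.Injective e := fun k k' hkk => by
      have h1 : (k : ℕ) ≠ i := k.2
      simp only [e, Sym2.eq_iff] at hkk
      rw [Subtype.ext_iff]
      omega
    have := measure_forall_le_mark (fun a => hXU.measurable_mark (e a))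
      (fun a => hXU.hasLaw_mark (e a)) (hXU.indep_marks.precomp he)
      (t := fun k => h (dist (X i ω) (X k ω))) (fun k => hh.dist_mem _ _)
    rw [← tsum_subtype ({i}ᶜ : Set ℕ) (fun k => edgeCost h (X i ω) (X k ω))]
    refine Eq.trans ?_ this
    congr 1
    ext ω'
    simp only [isolatedPairs, mem_ofPred_eq, hi, true_and, Subtype.forall, e]
    rfl
  · rw [Set.indicator_of_notMem hi]
    have : {ω' | ((fun i => X i ω), (fun e => U e ω')) ∈ isolatedPairs h K i} = ∅ := by
      ext ω'
      simp [isolatedPairs, hi]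
    rw [this, measure_empty]

/-- The probability that two points are isolated, each for its own profile. The mark of the pair
`{i, j}` has to exceed both thresholds, which gives the maximum; all other marks are distinct. -/
lemma IsMarkedPoissonProcess.measure_isolatedEvent_inter [IsProbabilityMeasure P]
    (hXU : IsMarkedPoissonProcess P lam X U) {h₁ h₂ : ℝ → ℝ} (hh₁ : IsProfile h₁)
    (hh₂ : IsProfile h₂) {K : Set (Space d)} (hK : MeasurableSet K) {i j : ℕ} (hij : i ≠ j) :
    P (isolatedEvent X U h₁ K i ∩ isolatedEvent X U h₂ K j)
      = ∫⁻ ω, (K ×ˢ K).indicator (fun p =>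
        ENNReal.ofReal (1 - max (h₁ (dist p.1 p.2)) (h₂ (dist p.1 p.2))) *
          expNeg (∑' k, ({i, j}ᶜ : Set ℕ).indicator (fun k =>
            edgeCost h₁ p.1 (X k ω) + edgeCost h₂ p.2 (X k ω)) k)) (X i ω, X j ω) ∂P := by
  rw [isolatedEvent_eq_preimage, isolatedEvent_eq_preimage, ← preimage_inter,
    hXU.measure_preimage ((hh₁.measurableSet_isolatedPairs hK i).inter
      (hh₂.measurableSet_isolatedPairs hK j))]
  refine lintegral_congr fun ω => ?_
  by_cases hij' : (X i ω, X j ω) ∈ K ×ˢ K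
  · rw [Set.indicator_of_mem hij']
    -- The marks that matter: that of `{i, j}`, those of `{i, k}` and those of `{j, k}`,
    -- where `k` is a third label.
    let T : Set ℕ := {i, j}ᶜ
    let e : Unit ⊕ (T ⊕ T) → Sym2 ℕ :=
      Sum.elim (fun _ => s(i, j)) (Sum.elim (fun k => s(i, k)) (fun k => s(j, k)))
    let t : Unit ⊕ (T ⊕ T) → ℝ :=
      Sum.elim (fun _ => max (h₁ (dist (X i ω) (X j ω))) (h₂ (dist (X i ω) (X j ω))))
        (Sum.elim (fun k => h₁ (dist (X i ω) (X k ω))) (fun k => h₂ (dist (X j ω) (X k ω))))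
    have hT : ∀ k : T, (k : ℕ) ≠ i ∧ (k : ℕ) ≠ j := fun k => by
      have h := k.2
      simp only [T, mem_compl_iff, mem_insert_iff, mem_singleton_iff, not_or] at h
      exact h
    have he : Function.Injective e := by
      rintro (a | k | k) (b | k' | k') hkk
      · rfl
      all_goals
        first
        | have h1 := hT k
        | skip
      all_goals
        first
        | have h2 := hT k'
        | skip
      all_goals
        simp only [e, Sum.elim_inl, Sum.elim_inr, Sym2.eq_iff] at hkk
        simp only [Sum.inl.injEq, Sum.inr.injEq, reduceCtorEq, Subtype.ext_iff]
        omega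
    have ht : ∀ a, t a ∈ Icc (0 : ℝ) 1 := by
      have h1 := hh₁.dist_mem (X i ω) (X j ω)
      have h2 := hh₂.dist_mem (X i ω) (X j ω)
      rintro (a | k | k)
      · exact ⟨le_max_of_le_left h1.1, max_le h1.2 h2.2⟩
      · exact hh₁.dist_mem _ _
      · exact hh₂.dist_mem _ _
    have key := measure_forall_le_mark (fun a => hXU.measurable_mark (e a))
      (fun a => hXU.hasLaw_mark (e a)) (hXU.indep_marks.precomp he) ht
    rw [Summable.tsum_sum ENNReal.summable ENNReal.summable,
      Summable.tsum_sum ENNReal.summable ENNReal.summable, tsum_fintype, expNeg_add] at key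
    have hsum : ∑' k, T.indicator (fun k => edgeCost h₁ (X i ω) (X k ω) +
        edgeCost h₂ (X j ω) (X k ω)) k
        = (∑' k : T, edgeCost h₁ (X i ω) (X k ω)) + ∑' k : T, edgeCost h₂ (X j ω) (X k ω) := by
      rw [← tsum_subtype T (fun k => edgeCost h₁ (X i ω) (X k ω) + edgeCost h₂ (X j ω) (X k ω)),
        ENNReal.tsum_add]
    have hmax : ENNReal.ofReal
        (1 - max (h₁ (dist (X i ω) (X j ω))) (h₂ (dist (X i ω) (X j ω)))) ≤ 1 := by
      have h0 : 0 ≤ max (h₁ (dist (X i ω) (X j ω))) (h₂ (dist (X i ω) (X j ω))) :=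
        (ht (Sum.inl ())).1
      exact ENNReal.ofReal_le_one.2 (by linarith)
    rw [hsum]
    simp only [Finset.univ_unique, Finset.sum_singleton, t, Sum.elim_inl, Sum.elim_inr,
      expNeg_negLog hmax] at key
    refine Eq.trans ?_ key
    congr 1
    ext ω'
    simp only [isolatedPairs, mem_ofPred_eq, mem_inter_iff, hij'.1, hij'.2, true_and, e,
      Sum.forall, Sum.elim_inl, Sum.elim_inr]
    constructor
    · rintro ⟨h1, h2⟩
      refine ⟨fun _ => max_le (h1 j hij.symm) ?_, fun k => h1 k (hT k).1, fun k => h2 k (hT k).2⟩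
      have h3 := h2 i hij
      rwa [dist_comm, Sym2.eq_swap] at h3
    · rintro ⟨h1, h2, h3⟩
      refine ⟨fun k hk => ?_, fun k hk => ?_⟩
      · by_cases hkj : k = j
        · subst hkj; exact (le_max_left _ _).trans (h1 ())
        · exact h2 ⟨k, by simp [T, hk, hkj]⟩
      · by_cases hki : k = i
        · subst hki
          rw [dist_comm, Sym2.eq_swap]
          exact (le_max_right _ _).trans (h1 ())
        · exact h3 ⟨k, by simp [T, hk, hki]⟩
  · rw [Set.indicator_of_notMem hij']
    have : {ω' | ((fun i => X i ω), (fun e => U e ω')) ∈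
        isolatedPairs h₁ K i ∩ isolatedPairs h₂ K j} = ∅ := by
      ext ω'
      simp only [mem_prod] at hij'
      simp only [isolatedPairs, mem_ofPred_eq, mem_inter_iff, mem_empty_iff_false, iff_false]
      tauto
    rw [this, measure_empty]

end

section

/-! ### Moments of the number of isolated vertices -/

variable {Ω : Type*} {d : ℕ} {X : ℕ → Ω → Space d} {U : Sym2 ℕ → Ω → ℝ}

variable {K : Set (Space d)} {a b h : ℝ → ℝ}

lemma isolatedCount_nonneg (X : ℕ → Ω → Space d) (U : Sym2 ℕ → Ω → ℝ) (h : ℝ → ℝ)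
    (K : Set (Space d)) (ω : Ω) : 0 ≤ isolatedCount X U h K ω := Nat.cast_nonneg _

/-- Isolation for the larger profile implies isolation for the smaller one. -/
lemma isolatedEvent_inter_of_le (hab : ∀ r, 0 ≤ r → a r ≤ b r) (i : ℕ) :
    isolatedEvent X U a K i ∩ isolatedEvent X U b K i = isolatedEvent X U b K i := by
  refine inter_eq_self_of_subset_right fun ω hω => ⟨hω.1, ?_⟩
  have := hω.2
  rw [graph_isIsolated_iff] at this ⊢
  exact fun k hk => (hab _ dist_nonneg).trans (this k hk)

variable [MeasurableSpace Ω] {P : Measure Ω} {lam : ℝ}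

/-- The number of isolated vertices as a sum of indicators; it is almost surely finite because `K`
contains finitely many points. -/
lemma IsMarkedPoissonProcess.ae_ofReal_isolatedCount (hXU : IsMarkedPoissonProcess P lam X U)
    (hK : MeasurableSet K) (hvK : volume K ≠ ⊤) (h : ℝ → ℝ) :
    ∀ᵐ ω ∂P, ENNReal.ofReal (isolatedCount X U h K ω)
      = ∑' i, (isolatedEvent X U h K i).indicator (fun _ => 1) ω := by
  filter_upwards [hXU.poisson.ae_pointCount_ne_top hK hvK] with ω hω
  let S : Set ℕ := {i | X i ω ∈ K ∧ (graph X U h ω).IsIsolated i}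
  have hS : S.Finite := (Set.encard_ne_top_iff.1 hω).subset fun i hi => hi.1
  have h1 : ∑' i, (isolatedEvent X U h K i).indicator (fun _ => (1 : ℝ≥0∞)) ω
      = ∑' i, S.indicator (fun _ => 1) i := rfl
  rw [h1, ← tsum_subtype S (fun _ => 1), ENNReal.tsum_set_one, ← hS.cast_ncard_eq]
  simp [isolatedCount, S]

lemma IsMarkedPoissonProcess.aemeasurable_isolatedCount (hXU : IsMarkedPoissonProcess P lam X U)
    (hK : MeasurableSet K) (hvK : volume K ≠ ⊤) (hh : IsProfile h) :
    AEMeasurable (isolatedCount X U h K) P := by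
  have hm : Measurable fun ω =>
      (∑' i, (isolatedEvent X U h K i).indicator (fun _ => (1 : ℝ≥0∞)) ω).toReal :=
    (Measurable.tsum fun i => measurable_const.indicator
      (hXU.measurableSet_isolatedEvent hh hK i)).ennreal_toReal
  refine ⟨_, hm, ?_⟩
  filter_upwards [hXU.ae_ofReal_isolatedCount hK hvK h] with ω hω
  rw [← hω, ENNReal.toReal_ofReal (isolatedCount_nonneg X U h K ω)]

/-- The integral of a profile over space. -/
def mass (d : ℕ) (h : ℝ → ℝ) : ℝ := ∫ z : Space d, h ‖z‖

/-- The integral of the product of two profiles that are centred at two points. -/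
def overlap (a b : ℝ → ℝ) (p : Space d × Space d) : ℝ := ∫ z, a (dist p.1 z) * b (dist p.2 z)

lemma lintegral_ofReal_profile (hh : IsProfile h) (hi : Integrable fun z : Space d => h ‖z‖)
    (x : Space d) : ∫⁻ z, ENNReal.ofReal (h (dist x z)) = ENNReal.ofReal (mass d h) := by
  have h1 : ∀ z, h (dist x z) = h ‖z - x‖ := fun z => by rw [dist_comm, dist_eq_norm]
  simp_rw [h1]
  rw [lintegral_sub_right_eq_self (fun z => ENNReal.ofReal (h ‖z‖)) x, mass,
    ofReal_integral_eq_lintegral_ofReal hi (ae_of_all _ fun z => (hh.mem_Icc _ (norm_nonneg z)).1)]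

lemma integrable_profile_dist (hi : Integrable fun z : Space d => h ‖z‖)
    (x : Space d) : Integrable fun z => h (dist x z) := by
  have h1 : ∀ z, h (dist x z) = h ‖z - x‖ := fun z => by rw [dist_comm, dist_eq_norm]
  simp_rw [h1]
  exact hi.comp_sub_right x

lemma integral_profile_dist (x : Space d) : ∫ z, h (dist x z) = mass d h := by
  have h1 : ∀ z, h (dist x z) = h ‖z - x‖ := fun z => by rw [dist_comm, dist_eq_norm]
  simp_rw [h1]
  exact integral_sub_right_eq_self (fun z : Space d => h ‖z‖) x

lemma IsProfile.mass_nonneg (hh : IsProfile h) : 0 ≤ mass d h :=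
  integral_nonneg fun z => (hh.mem_Icc _ (norm_nonneg z)).1

lemma IsMarkedPoissonProcess.lintegral_isolatedCount [IsProbabilityMeasure P]
    (hXU : IsMarkedPoissonProcess P lam X U) (hlam : 0 ≤ lam)
    (hK : MeasurableSet K) (hvK : volume K ≠ ⊤) (hh : IsProfile h)
    (hi : Integrable fun z : Space d => h ‖z‖) :
    ∑' i, P (isolatedEvent X U h K i)
      = ENNReal.ofReal (lam * volume.real K * Real.exp (-(lam * mass d h))) := by
  simp_rw [hXU.measure_isolatedEvent hh hK]
  rw [hXU.poisson.tsum_lintegral_expNeg_one hK hvK hh.measurable_edgeCost]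
  have h1 : ∀ x z : Space d, 1 - expNeg (edgeCost h x z) = ENNReal.ofReal (h (dist x z)) := by
    intro x z
    have := hh.dist_mem x z
    rw [hh.expNeg_edgeCost, ← ENNReal.ofReal_one, ← ENNReal.ofReal_sub _ (by linarith [this.2])]
    congr 1; ring
  simp_rw [h1, lintegral_ofReal_profile hh hi]
  rw [← ENNReal.ofReal_mul hlam, expNeg_ofReal (mul_nonneg hlam hh.mass_nonneg), setLIntegral_const,
    ← ofReal_measureReal hvK, ← ENNReal.ofReal_mul (by positivity), ← ENNReal.ofReal_mul hlam]
  congr 1; ring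

/-- The factor by which the presence of two isolated vertices at two given points is more likely
than for independent isolated vertices. -/
def pairFactor (lam : ℝ) (a b : ℝ → ℝ) (p : Space d × Space d) : ℝ :=
  (1 - max (a (dist p.1 p.2)) (b (dist p.1 p.2))) * Real.exp (lam * overlap a b p)

lemma integrable_mul_profile (hb : IsProfile b)
    (hia : Integrable fun z : Space d => a ‖z‖) (x y : Space d) :
    Integrable fun z => a (dist x z) * b (dist y z) := by
  refine (integrable_profile_dist hia x).mul_bdd (c := 1) ?_ (ae_of_all _ fun z => ?_)
  · exact (hb.measurable.comp (by fun_prop)).aestronglyMeasurable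
  · have := hb.dist_mem y z
    rw [Real.norm_eq_abs, abs_of_nonneg this.1]
    exact this.2

lemma overlap_nonneg (ha : IsProfile a) (hb : IsProfile b) (p : Space d × Space d) :
    0 ≤ overlap a b p :=
  integral_nonneg fun _ => mul_nonneg (ha.dist_mem _ _).1 (hb.dist_mem _ _).1

lemma overlap_le_mass (ha : IsProfile a) (hb : IsProfile b)
    (hia : Integrable fun z : Space d => a ‖z‖) (p : Space d × Space d) :
    overlap a b p ≤ mass d a := by
  rw [← integral_profile_dist p.1]
  exact integral_mono (integrable_mul_profile hb hia _ _) (integrable_profile_dist hia _)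
    fun _ => mul_le_of_le_one_right (ha.dist_mem _ _).1 (hb.dist_mem _ _).2

lemma measurable_overlap (ha : IsProfile a) (hb : IsProfile b) :
    Measurable (overlap (d := d) a b) := by
  have : Measurable fun q : (Space d × Space d) × Space d =>
      a (dist q.1.1 q.2) * b (dist q.1.2 q.2) :=
    (ha.measurable.comp (by fun_prop)).mul (hb.measurable.comp (by fun_prop))
  exact this.stronglyMeasurable.integral_prod_right'.measurable

lemma measurable_pairFactor (ha : IsProfile a) (hb : IsProfile b) :
    Measurable (pairFactor (d := d) lam a b) := by
  unfold pairFactor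
  have h1 := ha.measurable_dist (d := d)
  have h2 := hb.measurable_dist (d := d)
  have h3 := measurable_overlap (d := d) ha hb
  exact (measurable_const.sub (h1.max h2)).mul (measurable_const.mul h3).exp

lemma pairFactor_nonneg (ha : IsProfile a) (hb : IsProfile b) (p : Space d × Space d) :
    0 ≤ pairFactor lam a b p :=
  mul_nonneg (sub_nonneg.2 (max_le (ha.dist_mem _ _).2 (hb.dist_mem _ _).2)) (Real.exp_pos _).le

lemma pairFactor_le (hlam : 0 ≤ lam) (ha : IsProfile a) (hb : IsProfile b)
    (hia : Integrable fun z : Space d => a ‖z‖) (p : Space d × Space d) :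
    pairFactor lam a b p ≤ Real.exp (lam * mass d a) := by
  have h1 : 1 - max (a (dist p.1 p.2)) (b (dist p.1 p.2)) ≤ 1 :=
    sub_le_self _ (le_max_of_le_left (ha.dist_mem _ _).1)
  calc pairFactor lam a b p ≤ 1 * Real.exp (lam * overlap a b p) := by
        unfold pairFactor; gcongr
    _ ≤ _ := by
        rw [one_mul]
        gcongr
        exact overlap_le_mass ha hb hia p

lemma integrable_pairFactor (hlam : 0 ≤ lam) (hvK : volume K ≠ ⊤) (ha : IsProfile a)
    (hb : IsProfile b) (hia : Integrable fun z : Space d => a ‖z‖) :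
    Integrable (pairFactor lam a b) ((volume.restrict K).prod (volume.restrict K)) := by
  have : IsFiniteMeasure ((volume : Measure (Space d)).restrict K) := ⟨by simpa using hvK.lt_top⟩
  refine Integrable.of_bound (measurable_pairFactor ha hb).aestronglyMeasurable
    (Real.exp (lam * mass d a)) (ae_of_all _ fun p => ?_)
  rw [Real.norm_eq_abs, abs_of_nonneg (pairFactor_nonneg ha hb p)]
  exact pairFactor_le hlam ha hb hia p

/-- The exponent in the Laplace functional for two isolated points, by inclusion and exclusion. -/
lemma lintegral_one_sub_expNeg_edgeCost (ha : IsProfile a) (hb : IsProfile b)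
    (hia : Integrable fun z : Space d => a ‖z‖) (hib : Integrable fun z : Space d => b ‖z‖)
    (x y : Space d) :
    ∫⁻ z, (1 - expNeg (edgeCost a x z + edgeCost b y z))
      = ENNReal.ofReal (mass d a + mass d b - overlap a b (x, y)) := by
  have h1 : ∀ z, 1 - expNeg (edgeCost a x z + edgeCost b y z)
      = ENNReal.ofReal (a (dist x z) + b (dist y z) - a (dist x z) * b (dist y z)) := by
    intro z
    have h2 := ha.dist_mem x z
    have h3 := hb.dist_mem y z
    rw [expNeg_add, ha.expNeg_edgeCost, hb.expNeg_edgeCost, ← ENNReal.ofReal_mul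
      (by linarith [h2.2]), ← ENNReal.ofReal_one, ← ENNReal.ofReal_sub _
      (mul_nonneg (by linarith [h2.2]) (by linarith [h3.2]))]
    congr 1; ring
  simp_rw [h1]
  have hi1 := integrable_profile_dist hia x
  have hi2 := integrable_profile_dist hib y
  have hi3 := integrable_mul_profile hb hia x y
  have hi4 : Integrable fun z =>
      a (dist x z) + b (dist y z) - a (dist x z) * b (dist y z) := (hi1.add hi2).sub hi3
  rw [← ofReal_integral_eq_lintegral_ofReal hi4 (ae_of_all _ fun z => ?_)]
  · congr 1
    have hi5 : Integrable fun z => a (dist x z) + b (dist y z) := hi1.add hi2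
    calc _ = (∫ z, (a (dist x z) + b (dist y z))) - ∫ z, a (dist x z) * b (dist y z) :=
          integral_sub hi5 hi3
      _ = _ := by
          rw [integral_add hi1 hi2, integral_profile_dist, integral_profile_dist]; rfl
  · have h2 := ha.dist_mem x z
    have h3 := hb.dist_mem y z
    simp only [Pi.zero_apply]
    nlinarith [h2.1, h2.2, h3.1, h3.2]

/-- The expected number of ordered pairs of distinct points of `K`, the first isolated for `a` and
the second isolated for `b`. -/
lemma IsMarkedPoissonProcess.tsum_measure_inter [IsProbabilityMeasure P]
    (hXU : IsMarkedPoissonProcess P lam X U) (hlam : 0 ≤ lam)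
    (hK : MeasurableSet K) (hvK : volume K ≠ ⊤) (ha : IsProfile a) (hb : IsProfile b)
    (hia : Integrable fun z : Space d => a ‖z‖) (hib : Integrable fun z : Space d => b ‖z‖) :
    ∑' i, ∑' j, ({i}ᶜ : Set ℕ).indicator
        (fun j => P (isolatedEvent X U a K i ∩ isolatedEvent X U b K j)) j
      = ENNReal.ofReal (lam ^ 2 * (Real.exp (-(lam * (mass d a + mass d b))) *
        ∫ p, pairFactor lam a b p ∂((volume.restrict K).prod (volume.restrict K)))) := by
  have : IsFiniteMeasure ((volume : Measure (Space d)).restrict K) := ⟨by simpa using hvK.lt_top⟩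
  have hw : Measurable fun p : Space d × Space d =>
      ENNReal.ofReal (1 - max (a (dist p.1 p.2)) (b (dist p.1 p.2))) := by
    have h1 := ha.measurable_dist (d := d)
    have h2 := hb.measurable_dist (d := d)
    exact (measurable_const.sub (h1.max h2)).ennreal_ofReal
  have hψ : Measurable (Function.uncurry fun (p : Space d × Space d) z =>
      edgeCost a p.1 z + edgeCost b p.2 z) := by
    have h1 : Measurable fun q : (Space d × Space d) × Space d => edgeCost a q.1.1 q.2 :=
      measurable_negLog.comp (ENNReal.measurable_ofReal.comp
        (measurable_const.sub (ha.measurable.comp (by fun_prop))))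
    have h2 : Measurable fun q : (Space d × Space d) × Space d => edgeCost b q.1.2 q.2 :=
      measurable_negLog.comp (ENNReal.measurable_ofReal.comp
        (measurable_const.sub (hb.measurable.comp (by fun_prop))))
    exact h1.add h2
  have key := hXU.poisson.tsum_lintegral_expNeg_two hK hvK hw hψ
  have hL : ∀ i, (({i}ᶜ : Set ℕ).indicator
        (fun j => P (isolatedEvent X U a K i ∩ isolatedEvent X U b K j)))
      = ({i}ᶜ : Set ℕ).indicator (fun j => ∫⁻ ω, (K ×ˢ K).indicator (fun p =>
        ENNReal.ofReal (1 - max (a (dist p.1 p.2)) (b (dist p.1 p.2))) *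
          expNeg (∑' k, ({i, j}ᶜ : Set ℕ).indicator (fun k =>
            edgeCost a p.1 (X k ω) + edgeCost b p.2 (X k ω)) k)) (X i ω, X j ω) ∂P) := by
    intro i
    refine Set.indicator_congr fun j hj => ?_
    have hij : i ≠ j := fun hij => hj (by simp [hij])
    exact hXU.measure_isolatedEvent_inter ha hb hK hij
  simp_rw [hL]
  rw [key]
  simp_rw [lintegral_one_sub_expNeg_edgeCost ha hb hia hib]
  have hR : ∀ x y : Space d, ENNReal.ofReal (1 - max (a (dist x y)) (b (dist x y))) *
      expNeg (ENNReal.ofReal lam * ENNReal.ofReal (mass d a + mass d b - overlap a b (x, y)))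
      = ENNReal.ofReal (Real.exp (-(lam * (mass d a + mass d b))) * pairFactor lam a b (x, y)) := by
    intro x y
    have h1 : 0 ≤ mass d a + mass d b - overlap a b (x, y) := by
      have := overlap_le_mass ha hb hia (x, y)
      have := hb.mass_nonneg (d := d)
      linarith
    have h2 : 0 ≤ 1 - max (a (dist x y)) (b (dist x y)) :=
      sub_nonneg.2 (max_le (ha.dist_mem _ _).2 (hb.dist_mem _ _).2)
    rw [← ENNReal.ofReal_mul hlam, expNeg_ofReal (mul_nonneg hlam h1), ← ENNReal.ofReal_mul h2]
    congr 1
    have h3 : -(lam * (mass d a + mass d b - overlap a b (x, y)))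
        = -(lam * (mass d a + mass d b)) + lam * overlap a b (x, y) := by ring
    rw [h3, Real.exp_add, pairFactor]
    ring
  simp_rw [hR]
  have hm : Measurable fun p : Space d × Space d =>
      ENNReal.ofReal (Real.exp (-(lam * (mass d a + mass d b))) * pairFactor lam a b p) := by
    have := measurable_pairFactor (lam := lam) (d := d) ha hb
    fun_prop
  rw [← lintegral_prod _ hm.aemeasurable, ← ofReal_integral_eq_lintegral_ofReal
    ((integrable_pairFactor hlam hvK ha hb hia).const_mul _)
    (ae_of_all _ fun p => mul_nonneg (Real.exp_pos _).le (pairFactor_nonneg ha hb p)),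
    integral_const_mul, ← ENNReal.ofReal_mul hlam, ← ENNReal.ofReal_mul (by positivity), sq]

lemma IsMarkedPoissonProcess.lintegral_mul_isolatedCount [IsProbabilityMeasure P]
    (hXU : IsMarkedPoissonProcess P lam X U) (hlam : 0 ≤ lam)
    (hK : MeasurableSet K) (hvK : volume K ≠ ⊤) (ha : IsProfile a) (hb : IsProfile b)
    (hia : Integrable fun z : Space d => a ‖z‖) (hib : Integrable fun z : Space d => b ‖z‖)
    (hab : ∀ r, 0 ≤ r → a r ≤ b r) :
    ∫⁻ ω, ENNReal.ofReal (isolatedCount X U a K ω * isolatedCount X U b K ω) ∂P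
      = ENNReal.ofReal (lam * volume.real K * Real.exp (-(lam * mass d b)) +
        lam ^ 2 * (Real.exp (-(lam * (mass d a + mass d b))) *
        ∫ p, pairFactor lam a b p ∂((volume.restrict K).prod (volume.restrict K)))) := by
  have hma := hXU.measurableSet_isolatedEvent ha hK
  have hmb := hXU.measurableSet_isolatedEvent hb hK
  have h1 : ∀ᵐ ω ∂P, ENNReal.ofReal (isolatedCount X U a K ω * isolatedCount X U b K ω)
      = ∑' i, ∑' j, (isolatedEvent X U a K i ∩ isolatedEvent X U b K j).indicator
        (fun _ => 1) ω := by
    filter_upwards [hXU.ae_ofReal_isolatedCount hK hvK a, hXU.ae_ofReal_isolatedCount hK hvK b]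
      with ω hωa hωb
    rw [ENNReal.ofReal_mul (isolatedCount_nonneg X U a K ω), hωa, hωb, ← ENNReal.tsum_mul_right]
    refine tsum_congr fun i => ?_
    rw [← ENNReal.tsum_mul_left]
    refine tsum_congr fun j => ?_
    by_cases hi : ω ∈ isolatedEvent X U a K i <;> by_cases hj : ω ∈ isolatedEvent X U b K j <;>
      simp [hi, hj]
  have hmi : ∀ i j, Measurable fun ω => (isolatedEvent X U a K i ∩
      isolatedEvent X U b K j).indicator (fun _ => (1 : ℝ≥0∞)) ω := fun i j =>
    measurable_const.indicator ((hma i).inter (hmb j))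
  rw [lintegral_congr_ae h1, lintegral_tsum fun i => (Measurable.tsum fun j =>
    hmi i j).aemeasurable]
  have h2 : ∀ i, ∫⁻ ω, ∑' j, (isolatedEvent X U a K i ∩ isolatedEvent X U b K j).indicator
        (fun _ => (1 : ℝ≥0∞)) ω ∂P
      = P (isolatedEvent X U b K i) + ∑' j, ({i}ᶜ : Set ℕ).indicator
        (fun j => P (isolatedEvent X U a K i ∩ isolatedEvent X U b K j)) j := by
    intro i
    rw [lintegral_tsum fun j => (hmi i j).aemeasurable, ENNReal.tsum_eq_add_tsum_ite i]
    simp_rw [lintegral_indicator ((hma i).inter (hmb _)), setLIntegral_one]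
    rw [isolatedEvent_inter_of_le hab]
    congr 1
    refine tsum_congr fun j => ?_
    by_cases hj : j = i <;> simp [hj]
  simp_rw [h2]
  have hI : 0 ≤ ∫ p, pairFactor lam a b p ∂((volume.restrict K).prod (volume.restrict K)) :=
    integral_nonneg fun p => pairFactor_nonneg ha hb p
  rw [ENNReal.tsum_add, hXU.lintegral_isolatedCount hlam hK hvK hb hib,
    hXU.tsum_measure_inter hlam hK hvK ha hb hia hib, ← ENNReal.ofReal_add (by positivity)
    (by positivity)]

end

section

variable {Ω : Type*} {d : ℕ} {X : ℕ → Ω → Space d} {U : Sym2 ℕ → Ω → ℝ}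
variable {K : Set (Space d)} {a b h h' : ℝ → ℝ}
variable [MeasurableSpace Ω] {P : Measure Ω} {lam : ℝ}

lemma IsMarkedPoissonProcess.integral_isolatedCount [IsProbabilityMeasure P]
    (hXU : IsMarkedPoissonProcess P lam X U) (hlam : 0 ≤ lam)
    (hK : MeasurableSet K) (hvK : volume K ≠ ⊤) (hh : IsProfile h)
    (hi : Integrable fun z : Space d => h ‖z‖) :
    ∫ ω, isolatedCount X U h K ω ∂P
      = lam * volume.real K * Real.exp (-(lam * mass d h)) := by
  rw [integral_eq_lintegral_of_nonneg_ae (ae_of_all _ (isolatedCount_nonneg X U h K))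
    (hXU.aemeasurable_isolatedCount hK hvK hh).aestronglyMeasurable,
    lintegral_congr_ae (hXU.ae_ofReal_isolatedCount hK hvK h),
    lintegral_tsum fun i => (measurable_const.indicator
      (hXU.measurableSet_isolatedEvent hh hK i)).aemeasurable]
  simp_rw [lintegral_indicator (hXU.measurableSet_isolatedEvent hh hK _), setLIntegral_one]
  rw [hXU.lintegral_isolatedCount hlam hK hvK hh hi, ENNReal.toReal_ofReal (by positivity)]

/-- The mixed second moment. The first summand is the contribution of the diagonal: a point that is
isolated for `b` is isolated for `a`. -/
lemma IsMarkedPoissonProcess.integral_mul_isolatedCount [IsProbabilityMeasure P]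
    (hXU : IsMarkedPoissonProcess P lam X U) (hlam : 0 ≤ lam)
    (hK : MeasurableSet K) (hvK : volume K ≠ ⊤) (ha : IsProfile a) (hb : IsProfile b)
    (hia : Integrable fun z : Space d => a ‖z‖) (hib : Integrable fun z : Space d => b ‖z‖)
    (hab : ∀ r, 0 ≤ r → a r ≤ b r) :
    ∫ ω, isolatedCount X U a K ω * isolatedCount X U b K ω ∂P
      = lam * volume.real K * Real.exp (-(lam * mass d b)) +
        lam ^ 2 * (Real.exp (-(lam * (mass d a + mass d b))) *
        ∫ p, pairFactor lam a b p ∂((volume.restrict K).prod (volume.restrict K))) := by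
  have hI : 0 ≤ ∫ p, pairFactor lam a b p ∂((volume.restrict K).prod (volume.restrict K)) :=
    integral_nonneg fun p => pairFactor_nonneg ha hb p
  rw [integral_eq_lintegral_of_nonneg_ae (ae_of_all _ fun ω => mul_nonneg
    (isolatedCount_nonneg X U a K ω) (isolatedCount_nonneg X U b K ω))
    ((hXU.aemeasurable_isolatedCount hK hvK ha).mul
      (hXU.aemeasurable_isolatedCount hK hvK hb)).aestronglyMeasurable,
    hXU.lintegral_mul_isolatedCount hlam hK hvK ha hb hia hib hab,
    ENNReal.toReal_ofReal (by positivity)]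

lemma IsMarkedPoissonProcess.memLp_isolatedCount [IsProbabilityMeasure P]
    (hXU : IsMarkedPoissonProcess P lam X U) (hlam : 0 ≤ lam)
    (hK : MeasurableSet K) (hvK : volume K ≠ ⊤) (hh : IsProfile h)
    (hi : Integrable fun z : Space d => h ‖z‖) :
    MemLp (isolatedCount X U h K) 2 P := by
  have hm := (hXU.aemeasurable_isolatedCount hK hvK hh).aestronglyMeasurable
  rw [memLp_two_iff_integrable_sq hm]
  refine ⟨hm.pow 2, ?_⟩
  rw [hasFiniteIntegral_iff_ofReal (ae_of_all _ fun ω => sq_nonneg _)]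
  simp_rw [sq]
  rw [hXU.lintegral_mul_isolatedCount hlam hK hvK hh hh hi hi fun _ _ => le_rfl]
  exact ENNReal.ofReal_lt_top

/-! ### Integral bounds -/

lemma lintegral_prod_dist_le (hvK : volume K ≠ ⊤) (hh : IsProfile h)
    (hi : Integrable fun z : Space d => h ‖z‖) :
    ∫⁻ p : Space d × Space d, ENNReal.ofReal (h (dist p.1 p.2))
        ∂((volume.restrict K).prod (volume.restrict K))
      ≤ ENNReal.ofReal (volume.real K * mass d h) := by
  have hm : Measurable fun p : Space d × Space d => ENNReal.ofReal (h (dist p.1 p.2)) :=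
    hh.measurable_dist.ennreal_ofReal
  have : IsFiniteMeasure ((volume : Measure (Space d)).restrict K) := ⟨by simpa using hvK.lt_top⟩
  rw [lintegral_prod _ hm.aemeasurable, ENNReal.ofReal_mul measureReal_nonneg,
    ofReal_measureReal hvK, mul_comm, ← setLIntegral_const]
  refine lintegral_mono fun x => ?_
  rw [← lintegral_ofReal_profile hh hi x]
  exact setLIntegral_le_lintegral _ _

lemma lintegral_prod_overlap_le (hvK : volume K ≠ ⊤) (ha : IsProfile a)
    (hb : IsProfile b) (hia : Integrable fun z : Space d => a ‖z‖)
    (hib : Integrable fun z : Space d => b ‖z‖) :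
    ∫⁻ p : Space d × Space d, ENNReal.ofReal (overlap a b p)
        ∂((volume.restrict K).prod (volume.restrict K))
      ≤ ENNReal.ofReal (volume.real K * (mass d a * mass d b)) := by
  have : IsFiniteMeasure ((volume : Measure (Space d)).restrict K) := ⟨by simpa using hvK.lt_top⟩
  rw [lintegral_prod _ (measurable_overlap ha hb).ennreal_ofReal.aemeasurable,
    ENNReal.ofReal_mul measureReal_nonneg, ofReal_measureReal hvK, mul_comm, ← setLIntegral_const]
  refine lintegral_mono fun x => ?_
  have h1 : ∀ y : Space d, ENNReal.ofReal (overlap a b (x, y))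
      = ∫⁻ z, ENNReal.ofReal (a (dist x z)) * ENNReal.ofReal (b (dist y z)) := by
    intro y
    rw [overlap, ofReal_integral_eq_lintegral_ofReal (integrable_mul_profile hb hia x y)
      (ae_of_all _ fun z => mul_nonneg (ha.dist_mem _ _).1 (hb.dist_mem _ _).1)]
    simp_rw [ENNReal.ofReal_mul (ha.dist_mem _ _).1]
  have h2 : Measurable fun q : Space d × Space d =>
      ENNReal.ofReal (a (dist x q.2)) * ENNReal.ofReal (b (dist q.1 q.2)) :=
    (ha.measurable.comp (by fun_prop)).ennreal_ofReal.mul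
      (hb.measurable.comp (by fun_prop)).ennreal_ofReal
  calc ∫⁻ y in K, ENNReal.ofReal (overlap a b (x, y))
      ≤ ∫⁻ y, ENNReal.ofReal (overlap a b (x, y)) := setLIntegral_le_lintegral _ _
    _ = ∫⁻ y, ∫⁻ z, ENNReal.ofReal (a (dist x z)) * ENNReal.ofReal (b (dist y z)) := by
        simp_rw [h1]
    _ = ∫⁻ z, ∫⁻ y, ENNReal.ofReal (a (dist x z)) * ENNReal.ofReal (b (dist y z)) :=
        lintegral_lintegral_swap h2.aemeasurable
    _ = ENNReal.ofReal (mass d a * mass d b) := by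
        have h3 : ∀ z : Space d, ∫⁻ y, ENNReal.ofReal (b (dist y z))
            = ENNReal.ofReal (mass d b) := by
          intro z
          simp_rw [dist_comm _ z]
          exact lintegral_ofReal_profile hb hib z
        have h4 : Measurable fun z : Space d => ENNReal.ofReal (a (dist x z)) :=
          (ha.measurable.comp (by fun_prop)).ennreal_ofReal
        simp_rw [lintegral_const_mul' _ _ ENNReal.ofReal_ne_top, h3]
        rw [lintegral_mul_const _ h4, lintegral_ofReal_profile ha hia,
          ENNReal.ofReal_mul ha.mass_nonneg]
    _ ≤ _ := le_rfl

lemma integral_prod_dist_le (hvK : volume K ≠ ⊤) (hh : IsProfile h)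
    (hi : Integrable fun z : Space d => h ‖z‖) :
    Integrable (fun p : Space d × Space d => h (dist p.1 p.2))
      ((volume.restrict K).prod (volume.restrict K)) ∧
    ∫ p : Space d × Space d, h (dist p.1 p.2) ∂((volume.restrict K).prod (volume.restrict K))
      ≤ volume.real K * mass d h := by
  have h0 : 0 ≤ mass d h := hh.mass_nonneg
  have h1 := lintegral_prod_dist_le hvK hh hi
  have hn : ∀ p : Space d × Space d, 0 ≤ h (dist p.1 p.2) := fun p => (hh.dist_mem _ _).1
  refine ⟨⟨hh.measurable_dist.aestronglyMeasurable, ?_⟩, ?_⟩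
  · rw [hasFiniteIntegral_iff_ofReal (ae_of_all _ hn)]
    exact h1.trans_lt ENNReal.ofReal_lt_top
  · rw [integral_eq_lintegral_of_nonneg_ae (ae_of_all _ hn)
      hh.measurable_dist.aestronglyMeasurable]
    exact ENNReal.toReal_le_of_le_ofReal (by positivity) h1

lemma integral_prod_overlap_le (hvK : volume K ≠ ⊤) (ha : IsProfile a)
    (hb : IsProfile b) (hia : Integrable fun z : Space d => a ‖z‖)
    (hib : Integrable fun z : Space d => b ‖z‖) :
    Integrable (overlap (d := d) a b) ((volume.restrict K).prod (volume.restrict K)) ∧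
    ∫ p : Space d × Space d, overlap a b p ∂((volume.restrict K).prod (volume.restrict K))
      ≤ volume.real K * (mass d a * mass d b) := by
  have h0 : 0 ≤ mass d a := ha.mass_nonneg
  have h0' : 0 ≤ mass d b := hb.mass_nonneg
  have h1 := lintegral_prod_overlap_le hvK ha hb hia hib
  refine ⟨⟨(measurable_overlap ha hb).aestronglyMeasurable, ?_⟩, ?_⟩
  · rw [hasFiniteIntegral_iff_ofReal (ae_of_all _ (overlap_nonneg ha hb))]
    exact h1.trans_lt ENNReal.ofReal_lt_top
  · rw [integral_eq_lintegral_of_nonneg_ae (ae_of_all _ (overlap_nonneg ha hb))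
      (measurable_overlap ha hb).aestronglyMeasurable]
    exact ENNReal.toReal_le_of_le_ofReal (by positivity) h1

/-! ### Variance bounds -/

lemma integral_prod_const (hvK : volume K ≠ ⊤) (c : ℝ) :
    ∫ _ : Space d × Space d, c ∂((volume.restrict K).prod (volume.restrict K))
      = volume.real K ^ 2 * c := by
  have : IsFiniteMeasure ((volume : Measure (Space d)).restrict K) := ⟨by simpa using hvK.lt_top⟩
  rw [integral_const, smul_eq_mul, ← univ_prod_univ, measureReal_prod_prod,
    measureReal_restrict_apply_univ, sq]

/-- The variance of the number of isolated vertices is at least a fixed multiple of its mean.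
The factor `1 - exp (-1)` does not depend on the profile. -/
theorem IsMarkedPoissonProcess.le_variance_isolatedCount [IsProbabilityMeasure P]
    (hXU : IsMarkedPoissonProcess P lam X U) (hlam : 0 ≤ lam)
    (hK : MeasurableSet K) (hvK : volume K ≠ ⊤) (hh : IsProfile h)
    (hi : Integrable fun z : Space d => h ‖z‖) :
    (1 - Real.exp (-1)) * (lam * volume.real K * Real.exp (-(lam * mass d h)))
      ≤ variance (isolatedCount X U h K) P := by
  have : IsFiniteMeasure ((volume : Measure (Space d)).restrict K) := ⟨by simpa using hvK.lt_top⟩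
  have hH : 0 ≤ mass d h := hh.mass_nonneg
  set v := volume.real K with hv
  have hv0 : 0 ≤ v := measureReal_nonneg
  set π := ((volume : Measure (Space d)).restrict K).prod (volume.restrict K) with hπ
  set E := Real.exp (-(lam * mass d h)) with hE
  have hE0 : 0 < E := Real.exp_pos _
  rw [variance_eq_sub (hXU.memLp_isolatedCount hlam hK hvK hh hi)]
  simp only [Pi.pow_apply, sq]
  rw [hXU.integral_mul_isolatedCount hlam hK hvK hh hh hi hi (fun _ _ => le_rfl),
    hXU.integral_isolatedCount hlam hK hvK hh hi]
  have hEE : Real.exp (-(lam * (mass d h + mass d h))) = E ^ 2 := by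
    rw [hE, ← Real.exp_nat_mul]; congr 1; push_cast; ring
  rw [hEE]
  obtain ⟨hi1, hi2⟩ := integral_prod_dist_le hvK hh hi
  -- The exponential in `pairFactor` is at least `1`.
  have h1 : v ^ 2 - v * mass d h ≤ ∫ p, pairFactor lam h h p ∂π := by
    calc v ^ 2 - v * mass d h ≤ v ^ 2 * 1 - ∫ p, h (dist p.1 p.2) ∂π := by linarith
      _ = ∫ p, (1 - h (dist p.1 p.2)) ∂π := by
          rw [integral_sub (integrable_const _) hi1, integral_prod_const hvK]
      _ ≤ _ := by
          refine integral_mono ((integrable_const _).sub hi1)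
            (integrable_pairFactor hlam hvK hh hh hi) fun p => ?_
          have h2 := hh.dist_mem p.1 p.2
          have h3 : 1 ≤ Real.exp (lam * overlap h h p) :=
            Real.one_le_exp (mul_nonneg hlam (overlap_nonneg hh hh p))
          simp only [pairFactor, max_self]
          exact le_mul_of_one_le_right (by linarith [h2.2]) h3
  -- The function `t * exp (-t)` is at most `exp (-1)`.
  have h2 : lam * mass d h * E ≤ Real.exp (-1) := by
    have h3 := Real.add_one_le_exp (lam * mass d h - 1)
    calc lam * mass d h * E ≤ Real.exp (lam * mass d h - 1) * E := by gcongr; linarith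
      _ = Real.exp (-1) := by rw [hE, ← Real.exp_add]; congr 1; ring
  have h4 : lam ^ 2 * (E ^ 2 * (v ^ 2 - v * mass d h))
      ≤ lam * lam * (E ^ 2 * ∫ p, pairFactor lam h h p ∂π) := by
    rw [← sq]; gcongr
  have h5 : lam * v * E * (lam * mass d h * E) ≤ lam * v * E * Real.exp (-1) := by gcongr
  linarith [h4, h5]

/-- The mean value inequality for the exponential function. -/
lemma exp_sub_exp_le (x y : ℝ) : Real.exp x - Real.exp y ≤ (x - y) * Real.exp x := by
  have h1 := Real.add_one_le_exp (y - x)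
  have h2 : Real.exp y = Real.exp (y - x) * Real.exp x := by rw [← Real.exp_add]; congr 1; ring
  nlinarith [Real.exp_pos x]

lemma overlap_sub (hh : IsProfile h) (hi : Integrable fun z : Space d => h ‖z‖)
    (hi' : Integrable fun z : Space d => h' ‖z‖) (p : Space d × Space d) :
    overlap (fun r => h r - h' r) h p = overlap h h p - overlap h' h p := by
  rw [overlap, overlap, overlap, ← integral_sub (integrable_mul_profile hh hi _ _)
    (integrable_mul_profile hh hi' _ _)]
  simp only [sub_mul]

lemma overlap_mono_right (hh : IsProfile h) (hh' : IsProfile h')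
    (hi' : Integrable fun z : Space d => h' ‖z‖) (hle : ∀ r, 0 ≤ r → h' r ≤ h r)
    (p : Space d × Space d) : overlap h' h' p ≤ overlap h' h p :=
  integral_mono (integrable_mul_profile hh' hi' _ _) (integrable_mul_profile hh hi' _ _)
    fun _ => mul_le_mul_of_nonneg_left (hle _ dist_nonneg) (hh'.dist_mem _ _).1

lemma IsProfile.sub (hh : IsProfile h) (hh' : IsProfile h') (hle : ∀ r, 0 ≤ r → h' r ≤ h r) :
    IsProfile fun r => h r - h' r :=
  ⟨hh.measurable.sub hh'.measurable, fun r hr =>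
    ⟨sub_nonneg.2 (hle r hr), by linarith [(hh.mem_Icc r hr).2, (hh'.mem_Icc r hr).1]⟩⟩

lemma overlap_mono_left (hh : IsProfile h) (hh' : IsProfile h')
    (hi : Integrable fun z : Space d => h ‖z‖) (hi' : Integrable fun z : Space d => h' ‖z‖)
    (hle : ∀ r, 0 ≤ r → h' r ≤ h r) (p : Space d × Space d) : overlap h' h p ≤ overlap h h p := by
  have := overlap_nonneg (hh.sub hh' hle) hh p
  rw [overlap_sub hh hi hi'] at this
  linarith

lemma pairFactor_sub_le_left
    (hlam : 0 ≤ lam) (hh : IsProfile h) (hh' : IsProfile h')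
    (hi : Integrable fun z : Space d => h ‖z‖) (hi' : Integrable fun z : Space d => h' ‖z‖)
    (hle : ∀ r, 0 ≤ r → h' r ≤ h r) (p : Space d × Space d) :
    pairFactor lam h' h' p - pairFactor lam h' h p
      ≤ (h (dist p.1 p.2) - h' (dist p.1 p.2)) * Real.exp (lam * mass d h) := by
  have hm' := hh'.dist_mem p.1 p.2
  have hlep := hle (dist p.1 p.2) dist_nonneg
  have x1 : Real.exp (lam * overlap h' h' p) ≤ Real.exp (lam * overlap h' h p) :=
    Real.exp_le_exp.2 (mul_le_mul_of_nonneg_left (overlap_mono_right hh hh' hi' hle p) hlam)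
  have x2 : Real.exp (lam * overlap h' h p) ≤ Real.exp (lam * mass d h) :=
    Real.exp_le_exp.2 (mul_le_mul_of_nonneg_left ((overlap_mono_left hh hh' hi hi' hle p).trans
      (overlap_le_mass hh hh hi p)) hlam)
  simp only [pairFactor, max_self, max_eq_right hlep]
  linarith [mul_le_mul_of_nonneg_left x1 (sub_nonneg.2 hm'.2),
    mul_le_mul_of_nonneg_left x2 (sub_nonneg.2 hlep)]

lemma pairFactor_sub_le_right
    (hlam : 0 ≤ lam) (hh : IsProfile h) (hh' : IsProfile h')
    (hi : Integrable fun z : Space d => h ‖z‖) (hi' : Integrable fun z : Space d => h' ‖z‖)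
    (hle : ∀ r, 0 ≤ r → h' r ≤ h r) (p : Space d × Space d) :
    pairFactor lam h h p - pairFactor lam h' h p
      ≤ lam * overlap (fun r => h r - h' r) h p * Real.exp (lam * mass d h) := by
  have hm := hh.dist_mem p.1 p.2
  have hlep := hle (dist p.1 p.2) dist_nonneg
  have x1 : Real.exp (lam * overlap h h p) ≤ Real.exp (lam * mass d h) :=
    Real.exp_le_exp.2 (mul_le_mul_of_nonneg_left (overlap_le_mass hh hh hi p) hlam)
  have x2 : 0 ≤ Real.exp (lam * overlap h h p) - Real.exp (lam * overlap h' h p) :=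
    sub_nonneg.2 (Real.exp_le_exp.2
      (mul_le_mul_of_nonneg_left (overlap_mono_left hh hh' hi hi' hle p) hlam))
  have x3 := exp_sub_exp_le (lam * overlap h h p) (lam * overlap h' h p)
  rw [← mul_sub, ← overlap_sub hh hi hi'] at x3
  have x4 := mul_le_mul_of_nonneg_left x1
    (mul_nonneg hlam (overlap_nonneg (hh.sub hh' hle) hh p))
  simp only [pairFactor, max_self, max_eq_right hlep]
  linarith [mul_nonneg hm.1 x2]

lemma pairFactor_sub_one_le
    (hlam : 0 ≤ lam) (hh : IsProfile h) (hh' : IsProfile h')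
    (hi : Integrable fun z : Space d => h ‖z‖) (hi' : Integrable fun z : Space d => h' ‖z‖)
    (hle : ∀ r, 0 ≤ r → h' r ≤ h r) (p : Space d × Space d) :
    pairFactor lam h' h p - 1 ≤ lam * overlap h h p * Real.exp (lam * mass d h) := by
  have hm := hh.dist_mem p.1 p.2
  have hlep := hle (dist p.1 p.2) dist_nonneg
  have o := overlap_mono_left hh hh' hi hi' hle p
  have x1 : Real.exp (lam * overlap h' h p) ≤ Real.exp (lam * mass d h) :=
    Real.exp_le_exp.2 (mul_le_mul_of_nonneg_left (o.trans (overlap_le_mass hh hh hi p)) hlam)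
  have x2 := exp_sub_exp_le (lam * overlap h' h p) 0
  rw [Real.exp_zero, sub_zero] at x2
  have x3 := mul_le_mul (mul_le_mul_of_nonneg_left o hlam) x1 (Real.exp_pos _).le
    (mul_nonneg hlam (overlap_nonneg hh hh p))
  simp only [pairFactor, max_eq_right hlep]
  linarith [mul_nonneg hm.1 (Real.exp_pos (lam * overlap h' h p)).le]

/-- The contribution of a pair of points to the variance of the difference of two numbers of
isolated vertices. It is small when the two profiles are close, because the left-hand side equals
`E' ^ 2 (w' - w) + E ^ 2 (u - w) + (E' - E) ^ 2 (w - 1)`, where `w'`, `w`, `u` are the three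
pair factors. -/
lemma pairFactor_combination_le
    (hlam : 0 ≤ lam) (hh : IsProfile h) (hh' : IsProfile h')
    (hi : Integrable fun z : Space d => h ‖z‖) (hi' : Integrable fun z : Space d => h' ‖z‖)
    (hle : ∀ r, 0 ≤ r → h' r ≤ h r)
    {E E' c : ℝ} (hE : 0 ≤ E) (hE' : 0 ≤ E') (hE1 : E ≤ 1) (hE1' : E' ≤ 1) (hEE : E ≤ E')
    (hc : E' - E ≤ c) (p : Space d × Space d) :
    E' ^ 2 * pairFactor lam h' h' p - 2 * (E' * E * pairFactor lam h' h p) +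
        E ^ 2 * pairFactor lam h h p - (E' - E) ^ 2
      ≤ Real.exp (lam * mass d h) * ((h (dist p.1 p.2) - h' (dist p.1 p.2)) +
        lam * overlap (fun r => h r - h' r) h p + lam * c ^ 2 * overlap h h p) := by
  have hlep := hle (dist p.1 p.2) dist_nonneg
  have o3 : 0 ≤ overlap (fun r => h r - h' r) h p := overlap_nonneg (hh.sub hh' hle) hh p
  have o4 : 0 ≤ overlap h h p := overlap_nonneg hh hh p
  have he0 : 0 < Real.exp (lam * mass d h) := Real.exp_pos _
  have z1 := (mul_le_mul_of_nonneg_left (pairFactor_sub_le_left hlam hh hh' hi hi' hle p)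
    (sq_nonneg E')).trans (mul_le_of_le_one_left
      (mul_nonneg (sub_nonneg.2 hlep) he0.le) (pow_le_one₀ hE' hE1'))
  have z2 := (mul_le_mul_of_nonneg_left (pairFactor_sub_le_right hlam hh hh' hi hi' hle p)
    (sq_nonneg E)).trans (mul_le_of_le_one_left
      (mul_nonneg (mul_nonneg hlam o3) he0.le) (pow_le_one₀ hE hE1))
  have z3 := (mul_le_mul_of_nonneg_left (pairFactor_sub_one_le hlam hh hh' hi hi' hle p)
    (sq_nonneg (E' - E))).trans (mul_le_mul_of_nonneg_right
      (pow_le_pow_left₀ (sub_nonneg.2 hEE) hc 2) (mul_nonneg (mul_nonneg hlam o4) he0.le))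
  linarith

/-- The variance of the number of vertices that are isolated for the smaller connection function
but not for the larger one. The bound is proportional to the difference of the masses. -/
theorem IsMarkedPoissonProcess.variance_sub_isolatedCount_le [IsProbabilityMeasure P]
    (hXU : IsMarkedPoissonProcess P lam X U) (hlam : 0 ≤ lam)
    (hK : MeasurableSet K) (hvK : volume K ≠ ⊤) (hh : IsProfile h) (hh' : IsProfile h')
    (hi : Integrable fun z : Space d => h ‖z‖) (hi' : Integrable fun z : Space d => h' ‖z‖)
    (hle : ∀ r, 0 ≤ r → h' r ≤ h r) :
    variance (fun ω => isolatedCount X U h' K ω - isolatedCount X U h K ω) P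
      ≤ lam * volume.real K * (lam * (mass d h - mass d h')) *
        (1 + Real.exp (lam * mass d h) * (1 + lam * mass d h + (lam * mass d h) ^ 3)) := by
  have : IsFiniteMeasure ((volume : Measure (Space d)).restrict K) := ⟨by simpa using hvK.lt_top⟩
  have hq := hh.sub hh' hle
  have hiq : Integrable fun z : Space d => h ‖z‖ - h' ‖z‖ := hi.sub hi'
  have hQ : mass d (fun r => h r - h' r) = mass d h - mass d h' := integral_sub hi hi'
  have hQ0 : 0 ≤ mass d h - mass d h' := hQ ▸ hq.mass_nonneg
  have hH' : 0 ≤ mass d h' := hh'.mass_nonneg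
  set v := volume.real K with hv
  have hv0 : 0 ≤ v := measureReal_nonneg
  set π := ((volume : Measure (Space d)).restrict K).prod (volume.restrict K) with hπ
  set H := mass d h with hHdef
  set H' := mass d h' with hHdef'
  set E := Real.exp (-(lam * H)) with hE
  set E' := Real.exp (-(lam * H')) with hE'
  have hH : 0 ≤ H := by linarith
  have hE0 : 0 < E := Real.exp_pos _
  have hE0' : 0 < E' := Real.exp_pos _
  have hE1 : E ≤ 1 := Real.exp_le_one_iff.2 (by nlinarith)
  have hE1' : E' ≤ 1 := Real.exp_le_one_iff.2 (by nlinarith)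
  have hEE : E ≤ E' := Real.exp_le_exp.2 (by nlinarith)
  have hdE : E' - E ≤ lam * (H - H') := by
    have h1 : E = E' * Real.exp (-(lam * (H - H'))) := by
      rw [hE, hE', ← Real.exp_add]; congr 1; ring
    have h2 := Real.add_one_le_exp (-(lam * (H - H')))
    have h3 : 0 ≤ lam * (H - H') := mul_nonneg hlam hQ0
    nlinarith
  have hmem := hXU.memLp_isolatedCount hlam hK hvK hh hi
  have hmem' := hXU.memLp_isolatedCount hlam hK hvK hh' hi'
  have hint := hmem.integrable one_le_two
  have hint' := hmem'.integrable one_le_two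
  have hZ : ∫ ω, (isolatedCount X U h' K ω - isolatedCount X U h K ω) ∂P
      = lam * v * (E' - E) := by
    rw [integral_sub hint' hint, hXU.integral_isolatedCount hlam hK hvK hh hi,
      hXU.integral_isolatedCount hlam hK hvK hh' hi']
    ring
  have hZ2 : ∫ ω, (isolatedCount X U h' K ω - isolatedCount X U h K ω) ^ 2 ∂P
      = lam * v * (E' - E) + lam ^ 2 * (E' ^ 2 * (∫ p, pairFactor lam h' h' p ∂π) -
        2 * (E' * E * ∫ p, pairFactor lam h' h p ∂π) + E ^ 2 * ∫ p, pairFactor lam h h p ∂π) := by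
    have e1 := hXU.integral_mul_isolatedCount hlam hK hvK hh' hh' hi' hi' fun _ _ => le_rfl
    have e2 := hXU.integral_mul_isolatedCount hlam hK hvK hh' hh hi' hi hle
    have e3 := hXU.integral_mul_isolatedCount hlam hK hvK hh hh hi hi fun _ _ => le_rfl
    have x1 : Real.exp (-(lam * (H' + H'))) = E' ^ 2 := by
      rw [hE', ← Real.exp_nat_mul]; congr 1; push_cast; ring
    have x2 : Real.exp (-(lam * (H' + H))) = E' * E := by
      rw [hE', hE, ← Real.exp_add]; congr 1; ring
    have x3 : Real.exp (-(lam * (H + H))) = E ^ 2 := by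
      rw [hE, ← Real.exp_nat_mul]; congr 1; push_cast; ring
    rw [← hHdef', x1, ← hE'] at e1
    rw [← hHdef', ← hHdef, x2, ← hE] at e2
    rw [← hHdef, x3, ← hE] at e3
    have i1 : Integrable (fun ω => isolatedCount X U h' K ω * isolatedCount X U h' K ω) P :=
      hmem'.integrable_mul hmem'
    have i2 : Integrable (fun ω => isolatedCount X U h' K ω * isolatedCount X U h K ω) P :=
      hmem'.integrable_mul hmem
    have i3 : Integrable (fun ω => isolatedCount X U h K ω * isolatedCount X U h K ω) P :=
      hmem.integrable_mul hmem
    have i12 : Integrable (fun ω => isolatedCount X U h' K ω * isolatedCount X U h' K ω -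
        2 * (isolatedCount X U h' K ω * isolatedCount X U h K ω)) P := i1.sub (i2.const_mul 2)
    have hexp : ∀ ω, (isolatedCount X U h' K ω - isolatedCount X U h K ω) ^ 2
        = (isolatedCount X U h' K ω * isolatedCount X U h' K ω -
          2 * (isolatedCount X U h' K ω * isolatedCount X U h K ω)) +
          isolatedCount X U h K ω * isolatedCount X U h K ω := fun ω => by ring
    simp_rw [hexp]
    rw [integral_add i12 i3, integral_sub i1 (i2.const_mul 2),
      integral_const_mul, e1, e2, e3]
    ring
  set e := Real.exp (lam * H) with he
  have he0 : 0 < e := Real.exp_pos _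
  have hQ1 : H - H' ≤ H := by linarith
  -- The density of the variance with respect to pairs of points.
  have hF : ∀ p : Space d × Space d,
      E' ^ 2 * pairFactor lam h' h' p - 2 * (E' * E * pairFactor lam h' h p) +
        E ^ 2 * pairFactor lam h h p - (E' - E) ^ 2
      ≤ e * ((h (dist p.1 p.2) - h' (dist p.1 p.2)) + lam * overlap (fun r => h r - h' r) h p +
        lam * (lam * (H - H')) ^ 2 * overlap h h p) :=
    pairFactor_combination_le hlam hh hh' hi hi' hle hE0.le hE0'.le hE1 hE1' hEE hdE
  have hi1 := integrable_pairFactor (lam := lam) hlam hvK hh' hh' hi'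
  have hi2 := integrable_pairFactor (lam := lam) hlam hvK hh' hh hi'
  have hi3 := integrable_pairFactor (lam := lam) hlam hvK hh hh hi
  obtain ⟨j1, k1⟩ := integral_prod_dist_le hvK hq hiq
  obtain ⟨j2, k2⟩ := integral_prod_overlap_le hvK hq hh hiq hi
  obtain ⟨j3, k3⟩ := integral_prod_overlap_le hvK hh hh hi hi
  have m1 : Integrable (fun p => E' ^ 2 * pairFactor lam h' h' p) π := hi1.const_mul _
  have m2 : Integrable (fun p => 2 * (E' * E * pairFactor lam h' h p)) π :=
    (hi2.const_mul _).const_mul _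
  have m3 : Integrable (fun p => E ^ 2 * pairFactor lam h h p) π := hi3.const_mul _
  have m12 : Integrable (fun p => E' ^ 2 * pairFactor lam h' h' p -
      2 * (E' * E * pairFactor lam h' h p)) π := m1.sub m2
  have m123 : Integrable (fun p => E' ^ 2 * pairFactor lam h' h' p -
      2 * (E' * E * pairFactor lam h' h p) + E ^ 2 * pairFactor lam h h p) π := m12.add m3
  have mF : Integrable (fun p => E' ^ 2 * pairFactor lam h' h' p -
      2 * (E' * E * pairFactor lam h' h p) + E ^ 2 * pairFactor lam h h p - (E' - E) ^ 2) π :=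
    m123.sub (integrable_const _)
  have n2 : Integrable (fun p => lam * overlap (fun r => h r - h' r) h p) π := j2.const_mul _
  have n3 : Integrable (fun p => lam * (lam * (H - H')) ^ 2 * overlap h h p) π := j3.const_mul _
  have n12 : Integrable (fun p : Space d × Space d => (h (dist p.1 p.2) - h' (dist p.1 p.2)) +
      lam * overlap (fun r => h r - h' r) h p) π := j1.add n2
  have n123 : Integrable (fun p : Space d × Space d => (h (dist p.1 p.2) - h' (dist p.1 p.2)) +
      lam * overlap (fun r => h r - h' r) h p +
      lam * (lam * (H - H')) ^ 2 * overlap h h p) π := n12.add n3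
  have hFi := integral_mono mF (n123.const_mul e) hF
  rw [integral_sub m123 (integrable_const _), integral_add m12 m3, integral_sub m1 m2,
    integral_const_mul, integral_const_mul, integral_const_mul, integral_const_mul,
    integral_prod_const hvK, integral_const_mul, integral_add n12 n3, integral_add j1 n2,
    integral_const_mul, integral_const_mul] at hFi
  rw [hQ] at k1 k2
  have hvar : variance (fun ω => isolatedCount X U h' K ω - isolatedCount X U h K ω) P
      = lam * v * (E' - E) + lam ^ 2 * (E' ^ 2 * (∫ p, pairFactor lam h' h' p ∂π) -
        2 * (E' * E * ∫ p, pairFactor lam h' h p ∂π) + E ^ 2 * (∫ p, pairFactor lam h h p ∂π) -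
        v ^ 2 * (E' - E) ^ 2) := by
    have hmd : MemLp (fun ω => isolatedCount X U h' K ω - isolatedCount X U h K ω) 2 P :=
      hmem'.sub hmem
    rw [variance_eq_sub hmd]
    simp only [Pi.pow_apply]
    rw [hZ2, hZ]
    ring
  have hb : ∫ p : Space d × Space d, (h (dist p.1 p.2) - h' (dist p.1 p.2)) ∂π +
      lam * ∫ p, overlap (fun r => h r - h' r) h p ∂π +
      lam * (lam * (H - H')) ^ 2 * ∫ p, overlap h h p ∂π
      ≤ v * (H - H') + lam * (v * ((H - H') * H)) +
        lam * (lam * (H - H')) ^ 2 * (v * (H * H)) := by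
    gcongr
  -- One of the two factors `lam * (H - H')` is replaced by the larger `lam * H`.
  have hcube : lam * (lam * (H - H')) ^ 2 * (v * (H * H))
      ≤ v * (H - H') * (lam * H) ^ 3 := by
    have : (lam * (H - H')) * (lam * (lam * (H - H')) * (v * (H * H)))
        ≤ (lam * H) * (lam * (lam * (H - H')) * (v * (H * H))) := by gcongr
    calc _ = (lam * (H - H')) * (lam * (lam * (H - H')) * (v * (H * H))) := by ring
      _ ≤ _ := this
      _ = _ := by ring
  rw [hvar]
  calc _ ≤ lam * v * (lam * (H - H')) + lam ^ 2 * (e * (v * (H - H') +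
        lam * (v * ((H - H') * H)) + v * (H - H') * (lam * H) ^ 3)) := by
        have hFi' := hFi.trans (mul_le_mul_of_nonneg_left
          (hb.trans (add_le_add_right hcube _)) he0.le)
        gcongr
    _ = _ := by ring

end

section

/-! ### Normalization and approximation in distribution -/

section Normalization

variable {Ω : Type*} [MeasurableSpace Ω] {P : Measure Ω} [IsProbabilityMeasure P] {I J : Ω → ℝ}

lemma integral_abs_sub_integral_le (hI : MemLp I 2 P) :
    ∫ ω, |I ω - ∫ ω', I ω' ∂P| ∂P ≤ √(variance I P) := by
  have h1 : MemLp (fun ω => I ω - ∫ ω', I ω' ∂P) 2 P := hI.sub (memLp_const _)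
  have h2 : MemLp (fun ω => |I ω - ∫ ω', I ω' ∂P|) 2 P := h1.norm
  refine Real.le_sqrt_of_sq_le ?_
  -- The variance of the absolute deviation is nonnegative.
  have h3 := variance_nonneg (fun ω => |I ω - ∫ ω', I ω' ∂P|) P
  rw [variance_eq_sub h2] at h3
  rw [variance_eq_integral hI.aestronglyMeasurable.aemeasurable]
  simp only [Pi.pow_apply, sq_abs] at h3
  linarith

lemma sqrt_variance_add_le (hI : MemLp I 2 P) (hJ : MemLp J 2 P) :
    √(variance (fun ω => I ω + J ω) P) ≤ √(variance I P) + √(variance J P) := by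
  have h1 := variance_nonneg I P
  have h2 := variance_nonneg J P
  -- The Cauchy-Schwarz inequality for the covariance, from the variance of `I + t J`.
  have h3 : ∀ t : ℝ, 0 ≤ variance J P * (t * t) + 2 * cov[I, J; P] * t + variance I P := by
    intro t
    have h4 := variance_nonneg (fun ω => I ω + t * J ω) P
    rw [variance_fun_add hI (hJ.const_mul t), variance_const_mul, covariance_const_mul_right] at h4
    linarith
  have h5 := discrim_le_zero h3
  rw [discrim] at h5
  have h6 : cov[I, J; P] ≤ √(variance I P) * √(variance J P) := by
    rw [← Real.sqrt_mul h1]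
    exact Real.le_sqrt_of_sq_le (by linarith)
  rw [Real.sqrt_le_left (by positivity), variance_fun_add hI hJ, add_sq, Real.sq_sqrt h1,
    Real.sq_sqrt h2]
  linarith

lemma abs_sqrt_variance_sub_le (hI : MemLp I 2 P) (hJ : MemLp J 2 P) :
    |√(variance I P) - √(variance J P)| ≤ √(variance (fun ω => J ω - I ω) P) := by
  have h1 : MemLp (fun ω => J ω - I ω) 2 P := hJ.sub hI
  have h2 : MemLp (fun ω => I ω - J ω) 2 P := hI.sub hJ
  have h3 := sqrt_variance_add_le hI h1
  have h4 := sqrt_variance_add_le hJ h2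
  have h5 : variance (fun ω => I ω - J ω) P = variance (fun ω => J ω - I ω) P := by
    rw [variance_fun_sub hI hJ, variance_fun_sub hJ hI, covariance_comm]
    ring
  simp only [add_sub_cancel] at h3 h4
  rw [h5] at h4
  exact abs_le.2 ⟨by linarith, by linarith⟩

/-- Square integrable variables whose difference has a small variance, relative to the variance of
one of them, are close in mean after normalization. -/
lemma integral_abs_normalized_sub_le (hI : MemLp I 2 P) (hJ : MemLp J 2 P)
    (hpos : 0 < variance I P) :
    Integrable (fun ω => (I ω - ∫ ω', I ω' ∂P) / √(variance I P) -
      (J ω - ∫ ω', J ω' ∂P) / √(variance J P)) P ∧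
    ∫ ω, |(I ω - ∫ ω', I ω' ∂P) / √(variance I P) - (J ω - ∫ ω', J ω' ∂P) / √(variance J P)| ∂P
      ≤ 2 * (√(variance (fun ω => J ω - I ω) P) / √(variance I P)) := by
  set sI := √(variance I P) with hsI
  set sJ := √(variance J P) with hsJ
  set sZ := √(variance (fun ω => J ω - I ω) P) with hsZ
  have hI1 := hI.integrable one_le_two
  have hJ1 := hJ.integrable one_le_two
  have hZ : MemLp (fun ω => J ω - I ω) 2 P := hJ.sub hI
  have hZ1 : Integrable (fun ω => J ω - I ω) P := hZ.integrable one_le_two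
  have hs0 : 0 < sI := Real.sqrt_pos.2 hpos
  have hsJ0 : 0 ≤ sJ := Real.sqrt_nonneg _
  have hsZ0 : 0 ≤ sZ := Real.sqrt_nonneg _
  have hcI : Integrable (fun ω => I ω - ∫ ω', I ω' ∂P) P := hI1.sub (integrable_const _)
  have hcJ : Integrable (fun ω => J ω - ∫ ω', J ω' ∂P) P := hJ1.sub (integrable_const _)
  have hcZ : Integrable (fun ω => (J ω - I ω) - ∫ ω', (J ω' - I ω') ∂P) P :=
    hZ1.sub (integrable_const _)
  have habsZ : Integrable (fun ω => |(J ω - I ω) - ∫ ω', (J ω' - I ω') ∂P|) P := hcZ.abs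
  have habsJ : Integrable (fun ω => |J ω - ∫ ω', J ω' ∂P|) P := hcJ.abs
  have hint : Integrable (fun ω => (I ω - ∫ ω', I ω' ∂P) / sI - (J ω - ∫ ω', J ω' ∂P) / sJ) P :=
    (hcI.div_const _).sub (hcJ.div_const _)
  refine ⟨hint, ?_⟩
  have hpt : ∀ ω, |(I ω - ∫ ω', I ω' ∂P) / sI - (J ω - ∫ ω', J ω' ∂P) / sJ|
      ≤ sI⁻¹ * |(J ω - I ω) - ∫ ω', (J ω' - I ω') ∂P| +
        |sI⁻¹ - sJ⁻¹| * |J ω - ∫ ω', J ω' ∂P| := by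
    intro ω
    have h1 : (I ω - ∫ ω', I ω' ∂P) / sI - (J ω - ∫ ω', J ω' ∂P) / sJ
        = -(sI⁻¹ * ((J ω - I ω) - ∫ ω', (J ω' - I ω') ∂P)) +
          (sI⁻¹ - sJ⁻¹) * (J ω - ∫ ω', J ω' ∂P) := by
      rw [integral_sub hJ1 hI1]; ring
    rw [h1]
    refine (abs_add_le _ _).trans_eq ?_
    rw [abs_neg, abs_mul, abs_mul, abs_of_pos (inv_pos.2 hs0)]
  -- If `sJ = 0` then `sJ⁻¹ = 0`, and the left-hand side vanishes.
  have hrat : |sI⁻¹ - sJ⁻¹| * sJ ≤ sI⁻¹ * sZ := by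
    rcases hsJ0.eq_or_lt with h0 | h0
    · rw [← h0, mul_zero]; positivity
    · have h1 : sI⁻¹ - sJ⁻¹ = sI⁻¹ * (sJ - sI) * sJ⁻¹ := by field_simp
      rw [h1, abs_mul, abs_mul, abs_of_pos (inv_pos.2 hs0), abs_of_pos (inv_pos.2 h0), mul_assoc,
        inv_mul_cancel₀ h0.ne', mul_one, abs_sub_comm]
      exact mul_le_mul_of_nonneg_left (abs_sqrt_variance_sub_le hI hJ) (inv_pos.2 hs0).le
  have hsum : Integrable (fun ω => sI⁻¹ * |(J ω - I ω) - ∫ ω', (J ω' - I ω') ∂P| +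
      |sI⁻¹ - sJ⁻¹| * |J ω - ∫ ω', J ω' ∂P|) P := (habsZ.const_mul _).add (habsJ.const_mul _)
  calc _ ≤ ∫ ω, (sI⁻¹ * |(J ω - I ω) - ∫ ω', (J ω' - I ω') ∂P| +
        |sI⁻¹ - sJ⁻¹| * |J ω - ∫ ω', J ω' ∂P|) ∂P := integral_mono hint.abs hsum hpt
    _ = sI⁻¹ * ∫ ω, |(J ω - I ω) - ∫ ω', (J ω' - I ω') ∂P| ∂P +
        |sI⁻¹ - sJ⁻¹| * ∫ ω, |J ω - ∫ ω', J ω' ∂P| ∂P := by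
        rw [integral_add (habsZ.const_mul _) (habsJ.const_mul _), integral_const_mul,
          integral_const_mul]
    _ ≤ sI⁻¹ * sZ + |sI⁻¹ - sJ⁻¹| * sJ := by
        gcongr
        · exact integral_abs_sub_integral_le hZ
        · exact integral_abs_sub_integral_le hJ
    _ ≤ sI⁻¹ * sZ + sI⁻¹ * sZ := by gcongr
    _ = _ := by ring

end Normalization

/-- A sequence that is approximated in mean, up to any `ε`, by sequences that converge in
distribution to `Z` converges in distribution to `Z`. -/
theorem tendstoInDistribution_of_forall_approx {Ω : ℕ → Type*} [∀ n, MeasurableSpace (Ω n)]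
    {P : ∀ n, Measure (Ω n)} [∀ n, IsProbabilityMeasure (P n)] {Ω' : Type*} [MeasurableSpace Ω']
    {μ : Measure Ω'} [IsProbabilityMeasure μ] {Z : Ω' → ℝ} (hZ : AEMeasurable Z μ)
    {Y : ∀ n, Ω n → ℝ} (hY : ∀ n, AEMeasurable (Y n) (P n))
    (happ : ∀ ε : ℝ, 0 < ε → ∃ W : ∀ n, Ω n → ℝ, TendstoInDistribution W atTop Z P μ ∧
      ∀ᶠ n in atTop, Integrable (fun ω => Y n ω - W n ω) (P n) ∧
        ∫ ω, |Y n ω - W n ω| ∂(P n) ≤ ε) :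
    TendstoInDistribution Y atTop Z P μ := by
  refine ⟨hY, hZ, tendsto_iff_forall_lipschitz_integral_tendsto.2 ?_⟩
  rintro F ⟨M, hM⟩ ⟨L, hL⟩
  have hFc : Continuous F := hL.continuous
  have hFb : ∀ x, ‖F x‖ ≤ ‖F 0‖ + M := fun x => by
    have h1 : ‖F x - F 0‖ ≤ M := hM x 0
    have h2 := norm_le_norm_add_norm_sub' (F x) (F 0)
    linarith
  change Tendsto (fun n => ∫ x, F x ∂((P n).map (Y n))) atTop (𝓝 (∫ x, F x ∂(μ.map Z)))
  rw [Metric.tendsto_nhds]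
  intro ε hε
  have hL1 : (0 : ℝ) < L + 1 := by positivity
  obtain ⟨W, hW, hev⟩ := happ (ε / 2 / (L + 1)) (by positivity)
  have hWt := tendsto_iff_forall_lipschitz_integral_tendsto.1 hW.tendsto
  have hWF : Tendsto (fun n => ∫ x, F x ∂((P n).map (W n))) atTop (𝓝 (∫ x, F x ∂(μ.map Z))) :=
    hWt F ⟨M, hM⟩ ⟨L, hL⟩
  rw [Metric.tendsto_nhds] at hWF
  filter_upwards [hev, hWF (ε / 2) (half_pos hε)] with n ⟨hn, hnε⟩ hn2
  have hWm := hW.forall_aemeasurable n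
  have h1 : dist (∫ x, F x ∂((P n).map (Y n))) (∫ x, F x ∂((P n).map (W n))) ≤ ε / 2 := by
    rw [integral_map (hY n) hFc.aestronglyMeasurable, integral_map hWm hFc.aestronglyMeasurable]
    have i1 : Integrable (fun ω => F (Y n ω)) (P n) :=
      Integrable.of_bound (hFc.measurable.comp_aemeasurable (hY n)).aestronglyMeasurable _
        (ae_of_all _ fun ω => hFb _)
    have i2 : Integrable (fun ω => F (W n ω)) (P n) :=
      Integrable.of_bound (hFc.measurable.comp_aemeasurable hWm).aestronglyMeasurable _
        (ae_of_all _ fun ω => hFb _)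
    rw [dist_eq_norm, ← integral_sub i1 i2]
    calc ‖∫ ω, (F (Y n ω) - F (W n ω)) ∂(P n)‖
        ≤ ∫ ω, (L : ℝ) * |Y n ω - W n ω| ∂(P n) :=
          norm_integral_le_of_norm_le (hn.abs.const_mul _) (ae_of_all _ fun ω => by
            have := hL.dist_le_mul (Y n ω) (W n ω)
            rwa [dist_eq_norm, Real.dist_eq] at this)
      _ = L * ∫ ω, |Y n ω - W n ω| ∂(P n) := integral_const_mul _ _
      _ ≤ (L + 1) * (ε / 2 / (L + 1)) := by
          refine mul_le_mul (by linarith) hnε (integral_nonneg fun ω => abs_nonneg _) hL1.le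
      _ = ε / 2 := by field_simp
  calc _ ≤ _ := dist_triangle _ (∫ x, F x ∂((P n).map (W n))) _
    _ < ε / 2 + ε / 2 := add_lt_add_of_le_of_lt h1 hn2
    _ = ε := add_halves ε

/-! ### Scaling and truncation -/

variable {d : ℕ} {g : ℝ → ℝ}

lemma IsProfile.scale (hg : IsProfile g) (n : ℕ) : IsProfile (scale g n) :=
  ⟨hg.measurable.comp (measurable_const.mul measurable_id), fun _ hr =>
    hg.mem_Icc _ (mul_nonneg n.cast_nonneg hr)⟩

lemma IsProfile.trunc (hg : IsProfile g) (R : ℝ) : IsProfile (trunc g R) := by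
  refine ⟨Measurable.ite measurableSet_Iic hg.measurable measurable_const, fun r hr => ?_⟩
  unfold RandomConnection.trunc
  split_ifs
  · exact hg.mem_Icc r hr
  · exact ⟨le_rfl, zero_le_one⟩

lemma trunc_le (hg : IsProfile g) (R : ℝ) {r : ℝ} (hr : 0 ≤ r) : trunc g R r ≤ g r := by
  unfold trunc
  split_ifs
  · exact le_rfl
  · exact (hg.mem_Icc r hr).1

lemma integrable_trunc (hg : IsProfile g) (hi : Integrable fun z : Space d => g ‖z‖) (R : ℝ) :
    Integrable fun z : Space d => trunc g R ‖z‖ := by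
  refine hi.mono' ((hg.trunc R).measurable.comp measurable_norm).aestronglyMeasurable
    (ae_of_all _ fun z => ?_)
  rw [Real.norm_eq_abs, abs_of_nonneg ((hg.trunc R).mem_Icc _ (norm_nonneg z)).1]
  exact trunc_le hg R (norm_nonneg z)

lemma scale_norm (g : ℝ → ℝ) (n : ℕ) (z : Space d) : scale g n ‖z‖ = g ‖(n : ℝ) • z‖ := by
  rw [norm_smul, Real.norm_natCast, scale]

lemma integrable_scale (hi : Integrable fun z : Space d => g ‖z‖) {n : ℕ} (hn : 0 < n) :
    Integrable fun z : Space d => scale g n ‖z‖ := by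
  simp_rw [scale_norm]
  exact hi.comp_smul (Nat.cast_ne_zero.2 hn.ne')

lemma mass_scale (g : ℝ → ℝ) (n : ℕ) : mass d (scale g n) = mass d g / (n : ℝ) ^ d := by
  unfold mass
  simp_rw [scale_norm]
  rw [Measure.integral_comp_smul volume (fun z : Space d => g ‖z‖) (n : ℝ),
    finrank_euclideanSpace_fin, abs_of_nonneg (by positivity), smul_eq_mul, div_eq_inv_mul]

lemma exists_mass_trunc (hg : IsProfile g) (hi : Integrable fun z : Space d => g ‖z‖) {δ : ℝ}
    (hδ : 0 < δ) : ∃ R : ℝ, 0 < R ∧ mass d g - mass d (trunc g R) ≤ δ := by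
  have h1 : Tendsto (fun m : ℕ => mass d (trunc g m)) atTop (𝓝 (mass d g)) := by
    refine tendsto_integral_of_dominated_convergence (fun z : Space d => g ‖z‖)
      (fun m => ((hg.trunc m).measurable.comp measurable_norm).aestronglyMeasurable) hi
      (fun m => ae_of_all _ fun z => ?_) (ae_of_all _ fun z => ?_)
    · rw [Real.norm_eq_abs, abs_of_nonneg ((hg.trunc m).mem_Icc _ (norm_nonneg z)).1]
      exact trunc_le hg m (norm_nonneg z)
    · refine tendsto_const_nhds.congr' ?_
      filter_upwards [eventually_ge_atTop ⌈‖z‖⌉₊] with m hm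
      rw [trunc, if_pos (Nat.ceil_le.1 hm)]
  have h2 := h1.eventually_const_lt (show mass d g - δ < mass d g by linarith)
  obtain ⟨m, hm, hm0⟩ := (h2.and (eventually_gt_atTop 0)).exists
  exact ⟨m, Nat.cast_pos.2 hm0, by linarith⟩

lemma isolatedCount_congr {Ω : Type*} {a b : ℝ → ℝ} (hab : ∀ r, 0 ≤ r → a r = b r)
    (X : ℕ → Ω → Space d) (U : Sym2 ℕ → Ω → ℝ) (K : Set (Space d)) :
    isolatedCount X U a K = isolatedCount X U b K := by
  have : graph X U a = graph X U b := by
    funext ω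
    ext i j
    simp only [graph, hab _ dist_nonneg]
  unfold isolatedCount
  rw [this]

/-! ### The limit theorem -/

/-- The truncation error is small compared to the fluctuations, uniformly in the intensity as long
as the mean number of neighbours of a point stays bounded. -/
lemma IsMarkedPoissonProcess.variance_sub_le_mul_variance {Ω : Type*} [MeasurableSpace Ω]
    {P : Measure Ω} [IsProbabilityMeasure P] {X : ℕ → Ω → Space d} {U : Sym2 ℕ → Ω → ℝ} {lam : ℝ}
    {K : Set (Space d)} {h h' : ℝ → ℝ} (hXU : IsMarkedPoissonProcess P lam X U) (hlam : 0 < lam)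
    (hK : MeasurableSet K) (hvK : volume K ≠ ⊤) (hK0 : volume K ≠ 0)
    (hh : IsProfile h) (hh' : IsProfile h')
    (hi : Integrable fun z : Space d => h ‖z‖) (hi' : Integrable fun z : Space d => h' ‖z‖)
    (hle : ∀ r, 0 ≤ r → h' r ≤ h r) {T q : ℝ} (hT : lam * mass d h ≤ T)
    (hq : lam * (mass d h - mass d h') ≤ q) :
    0 < variance (isolatedCount X U h K) P ∧
    variance (fun ω => isolatedCount X U h' K ω - isolatedCount X U h K ω) P
      ≤ q * ((1 + Real.exp T * (1 + T + T ^ 3)) * Real.exp T / (1 - Real.exp (-1))) *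
        variance (isolatedCount X U h K) P := by
  have hc : 0 < 1 - Real.exp (-1) := sub_pos.2 (Real.exp_lt_one_iff.2 (by norm_num))
  have hv : 0 < volume.real K := ENNReal.toReal_pos hK0 hvK
  have ht0 : 0 ≤ lam * mass d h := mul_nonneg hlam.le hh.mass_nonneg
  have hq0 : 0 ≤ lam * (mass d h - mass d h') := mul_nonneg hlam.le
    (sub_nonneg.2 (integral_mono hi' hi fun z => hle _ (norm_nonneg z)))
  have hV := hXU.le_variance_isolatedCount hlam.le hK hvK hh hi
  have hZ := hXU.variance_sub_isolatedCount_le hlam.le hK hvK hh hh' hi hi' hle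
  have hV' : (1 - Real.exp (-1)) * (lam * volume.real K * Real.exp (-T))
      ≤ variance (isolatedCount X U h K) P := by
    refine le_trans ?_ hV
    gcongr
  refine ⟨lt_of_lt_of_le (by positivity) hV', hZ.trans ?_⟩
  have hT0 : 0 ≤ T := ht0.trans hT
  have hq0' : 0 ≤ q := hq0.trans hq
  calc lam * volume.real K * (lam * (mass d h - mass d h')) * (1 + Real.exp (lam * mass d h) *
        (1 + lam * mass d h + (lam * mass d h) ^ 3))
      ≤ lam * volume.real K * q * (1 + Real.exp T * (1 + T + T ^ 3)) := by gcongr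
    _ = q * ((1 + Real.exp T * (1 + T + T ^ 3)) * Real.exp T / (1 - Real.exp (-1))) *
        ((1 - Real.exp (-1)) * (lam * volume.real K * Real.exp (-T))) := by
        rw [Real.exp_neg T]
        field_simp
    _ ≤ _ := by gcongr

/-- The limit theorem for profiles, which need not be monotone. -/
theorem satisfiesCLT_isolatedCount_of_trunc (hg : IsProfile g)
    (hi : Integrable fun z : Space d => g ‖z‖) {K : Set (Space d)} (hK : MeasurableSet K)
    (hvK : volume K ≠ ⊤) (hK0 : volume K ≠ 0) {lam : ℝ} (hlam : 0 < lam) {lamn : ℕ → ℝ}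
    (hlamn : ∀ n, 0 < lamn n)
    (hlim : Tendsto (fun n : ℕ => lamn n / (n : ℝ) ^ d) atTop (𝓝 lam))
    {Ω : ℕ → Type*} [∀ n, MeasurableSpace (Ω n)] {P : ∀ n, Measure (Ω n)}
    [∀ n, IsProbabilityMeasure (P n)] {X : ∀ n, ℕ → Ω n → Space d} {U : ∀ n, Sym2 ℕ → Ω n → ℝ}
    (hXU : ∀ n, IsMarkedPoissonProcess (P n) (lamn n) (X n) (U n))
    (hCLT : ∀ R : ℝ, 0 < R →
      SatisfiesCLT P (fun n => isolatedCount (X n) (U n) (truncScale g R n) K)) :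
    SatisfiesCLT P (fun n => isolatedCount (X n) (U n) (scale g n) K) := by
  refine tendstoInDistribution_of_forall_approx aemeasurable_id
    (fun n => (((hXU n).aemeasurable_isolatedCount hK hvK (hg.scale n)).sub_const _).div_const _)
    fun ε hε => ?_
  set H := mass d g with hH
  have hH0 : 0 ≤ H := hg.mass_nonneg
  set T := (lam + 1) * H with hT
  have hT0 : 0 ≤ T := by positivity
  have hc : 0 < 1 - Real.exp (-1) := sub_pos.2 (Real.exp_lt_one_iff.2 (by norm_num))
  set C := (1 + Real.exp T * (1 + T + T ^ 3)) * Real.exp T / (1 - Real.exp (-1)) with hC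
  have hC0 : 0 < C := by positivity
  -- With this choice the variance of the difference is at most `(ε / 2) ^ 2` times the variance.
  obtain ⟨R, hR, hRδ⟩ := exists_mass_trunc (d := d) hg hi
    (δ := (ε / 2) ^ 2 / ((lam + 1) * C)) (by positivity)
  refine ⟨_, hCLT R hR, ?_⟩
  filter_upwards [hlim.eventually_lt_const (show lam < lam + 1 by linarith),
    eventually_gt_atTop 0] with n hn hn0
  have hhs := hg.scale n
  have hht := (hg.trunc R).scale n
  have his := integrable_scale hi hn0
  have hit := integrable_scale (integrable_trunc hg hi R) hn0
  have hQ0 : 0 ≤ H - mass d (trunc g R) := sub_nonneg.2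
    (integral_mono (integrable_trunc hg hi R) hi fun z => trunc_le hg R (norm_nonneg z))
  rw [truncScale_eq_scale_trunc g R hn0]
  have hTn : lamn n * mass d (scale g n) ≤ T := by
    rw [mass_scale, ← mul_div_assoc, mul_div_right_comm]
    exact mul_le_mul_of_nonneg_right hn.le hH0
  have hqn : lamn n * (mass d (scale g n) - mass d (scale (trunc g R) n))
      ≤ (ε / 2) ^ 2 / C := by
    rw [mass_scale, mass_scale, ← sub_div, ← mul_div_assoc, mul_div_right_comm]
    calc _ ≤ (lam + 1) * ((ε / 2) ^ 2 / ((lam + 1) * C)) := by gcongr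
      _ = _ := by field_simp
  obtain ⟨hpos, hvar⟩ := (hXU n).variance_sub_le_mul_variance (hlamn n) hK hvK hK0 hhs hht his hit
    (fun r hr => trunc_le hg R (mul_nonneg n.cast_nonneg hr)) hTn hqn
  rw [← hC, div_mul_cancel₀ _ hC0.ne'] at hvar
  have hmI := (hXU n).memLp_isolatedCount (hlamn n).le hK hvK hhs his
  have hmJ := (hXU n).memLp_isolatedCount (hlamn n).le hK hvK hht hit
  obtain ⟨hint, hle⟩ := integral_abs_normalized_sub_le hmI hmJ hpos
  refine ⟨hint, hle.trans ?_⟩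
  have hsq : √(variance (fun ω => isolatedCount (X n) (U n) (scale (trunc g R) n) K ω -
      isolatedCount (X n) (U n) (scale g n) K ω) (P n))
      ≤ ε / 2 * √(variance (isolatedCount (X n) (U n) (scale g n) K) (P n)) := by
    refine (Real.sqrt_le_sqrt hvar).trans_eq ?_
    rw [Real.sqrt_mul (sq_nonneg _), Real.sqrt_sq (by positivity)]
  have := (div_le_iff₀ (Real.sqrt_pos.2 hpos)).2 hsq
  linarith

end

end RandomConnection

end

theorem mainTheorem3
    (d : ℕ) (hd : 0 < d)
    (g : ℝ → ℝ) (hg : RandomConnection.IsConnectionFunction d g)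
    (K : Set (RandomConnection.Space d)) (hKb : Bornology.IsBounded K) (hKm : MeasurableSet K)
    (hKi : (interior K).Nonempty) (hKf : volume (frontier K) = 0)
    (lam : ℝ) (hlam : 0 < lam)
    (lamn : ℕ → ℝ) (hlamn : ∀ n, 0 < lamn n)
    (hlim : Tendsto (fun n : ℕ => lamn n / (n : ℝ) ^ d) atTop (𝓝 lam))
    (Ω : ℕ → Type*) [∀ n, MeasurableSpace (Ω n)] (P : ∀ n, Measure (Ω n))
    [∀ n, IsProbabilityMeasure (P n)]
    (X : ∀ n, ℕ → Ω n → RandomConnection.Space d) (U : ∀ n, Sym2 ℕ → Ω n → ℝ)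
    (hXU : ∀ n, RandomConnection.IsMarkedPoissonProcess (P n) (lamn n) (X n) (U n))
    (hCLT : ∀ R : ℝ, 0 < R → RandomConnection.SatisfiesCLT P
      (fun n => RandomConnection.isolatedCount (X n) (U n)
        (RandomConnection.truncScale g R n) K)) :
    RandomConnection.SatisfiesCLT P
      (fun n => RandomConnection.isolatedCount (X n) (U n)
        (RandomConnection.scale g n) K) := by
  -- Extending `g` by its value at `0` to negative arguments makes it antitone, hence measurable,
  -- and does not change the models.
  let g₀ : ℝ → ℝ := fun r => g (max r 0)
  have hg₀ : ∀ r, 0 ≤ r → g₀ r = g r := fun r hr => by simp only [g₀, max_eq_left hr]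
  have hanti : Antitone g₀ := fun r s hrs =>
    hg.antitoneOn (le_max_right r 0) (le_max_right s 0) (max_le_max_right 0 hrs)
  have hprof : RandomConnection.IsProfile g₀ :=
    ⟨hanti.measurable, fun r hr => by rw [hg₀ r hr]; exact hg.mem_Icc r hr⟩
  have hint : Integrable fun z : RandomConnection.Space d => g₀ ‖z‖ := by
    simp_rw [hg₀ _ (norm_nonneg _)]
    exact hg.integrable
  have hscale : ∀ n : ℕ, ∀ r : ℝ, 0 ≤ r →
      RandomConnection.scale g₀ n r = RandomConnection.scale g n r := fun n r hr =>
    hg₀ _ (mul_nonneg n.cast_nonneg hr)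
  have htrunc : ∀ (R : ℝ) (n : ℕ) (r : ℝ), 0 ≤ r →
      RandomConnection.truncScale g₀ R n r = RandomConnection.truncScale g R n r :=
    fun R n r hr => by
      simp only [RandomConnection.truncScale, RandomConnection.trunc, hscale n r hr]
  have hK0 : volume K ≠ 0 := fun h0 => (isOpen_interior.measure_pos volume hKi).ne'
    (measure_mono_null interior_subset h0)
  have key := RandomConnection.satisfiesCLT_isolatedCount_of_trunc hprof hint hKm
    hKb.measure_lt_top.ne hK0 hlam hlamn hlim hXU fun R hR => by
      simp_rw [RandomConnection.isolatedCount_congr (htrunc R _)]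
      exact hCLT R hR
  simp_rw [RandomConnection.isolatedCount_congr (hscale _)] at key
  exact key
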